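/- Let $\Omega$ be a compact metric space with a $\sigma$-algebra $\Sigma$ containing the open sets and a probability measure $\mathbb P$ on $\Sigma$, and let $(T_x)_{x\in\mathbb R^3}$ be maps $T_x:\Omega\to\Omega$ such that $T_0=\mathrm{Id}$, $T_{x+y}=T_x\circ T_y$, each $T_x$ is measurable and preserves $\mathbb P$, the map $(x,\omega)\mapsto T_x\omega$ is continuous on $\mathbb R^3\times\Omega$ and measurable with respect to the completion of $\mathrm dx\otimes\mathbb P$, and every $A\in\Sigma$ with $T_xA=A$ up to a $\mathbb P$-null set for every $x\in\mathbb R^3$ satisfies $\mathbb P(A)\in\{0,1\}$. Write $\mathbb E[f]=\int_\Omega f\,\mathrm d\mathbb P$. Let $D\subset\mathbb R^3$ be open and bounded, $\mu_0\in\mathbb R$ and $h_a\in L^2(D;\mathbb R^3)$. Let $M_{\mathrm{sat}}\in L^\infty(\Omega)$ with $M_{\mathrm{sat}}\ge 0$ almost surely. Let $\varphi:\Omega\times\mathbb S^2\to\mathbb R$ be such that for every $s\in\mathbb S^2$ one has $\varphi(\cdot,s)\in L^\infty(\Omega)$ and $\varphi(\cdot,s)\ge0$ almost surely, and such that for some $L>0$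 and $\mathbb P$-almost every $\omega$, $$|\varphi(\omega,s_1)-\varphi(\omega,s_2)|\le L\,|s_1-s_2|\qquad\text{for all } s_1,s_2\in\mathbb S^2 .$$ For $\varepsilon>0$, $\omega\in\Omega$ and $m\in L^2(D;\mathbb S^2)$ (the maps $m\in L^2(D;\mathbb R^3)$ with $|m|=1$ a.e. in $D$) put $$\mathcal A_\varepsilon(m)=\int_D\varphi\big(T_{x/\varepsilon}\omega,m(x)\big)\,\mathrm dx,\qquad \mathcal Z_\varepsilon(m)=-\mu_0\int_D h_a(x)\cdot M_{\mathrm{sat}}(T_{x/\varepsilon}\omega)\,m(x)\,\mathrm dx,$$ $$\mathcal A_{\mathrm{hom}}(m)=\int_D\mathbb E[\varphi](m(x))\,\mathrm dx,\qquad \mathcal Z_{\mathrm{hom}}(m)=-\mu_0\int_D h_a(x)\cdot\mathbb E[M_{\mathrm{sat}}]\,m(x)\,\mathrm dx,$$ where $\mathbb E[\varphi](s)=\int_\Omega\varphi(\omega,s)\,\mathrm d\mathbb P(\omega)$. Then for $\mathbb P$-almost every $\omega\in\Omega$ the following holds (with one exceptional null set, independent of $\varepsilon$ and $m$). 1. The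 integrands above are integrable on $D$ for all $\varepsilon>0$ and all $m\in L^2(D;\mathbb S^2)$. 2. As $\varepsilon\to0$, $(\mathcal A_\varepsilon)_{\varepsilon>0}$ and $(\mathcal Z_\varepsilon)_{\varepsilon>0}$ converge continuously to $\mathcal A_{\mathrm{hom}}$ and $\mathcal Z_{\mathrm{hom}}$, respectively, with respect to the strong topology of $L^2(D;\mathbb S^2)$: for every $m_0\in L^2(D;\mathbb S^2)$, $$\mathcal A_\varepsilon(m)\to\mathcal A_{\mathrm{hom}}(m_0)\quad\text{and}\quad \mathcal Z_\varepsilon(m)\to\mathcal Z_{\mathrm{hom}}(m_0)\qquad\text{as }\varepsilon\to0^+ \text{ and } m\to m_0 \text{ in } L^2(D;\mathbb S^2).$$ 3. The same holds with respect to weak convergence in $H^1(D;\mathbb S^2)=\{m\in H^1(D;\mathbb R^3): |m|=1 \text{ a.e.}\}$: if $\varepsilon_j>0$, $\varepsilon_j\to0$, $m_j,m_0\in H^1(D;\mathbb S^2)$ and $m_j\rightharpoonup m_0$ weakly in $H^1(D;\mathbb R^3)$, then $\mathcal A_{\varepsilon_j}(m_j)\to\mathcal A_{\mathrm{hom}}(m_0)$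 and $\mathcal Z_{\varepsilon_j}(m_j)\to\mathcal Z_{\mathrm{hom}}(m_0)$. -/

import Mathlib

open MeasureTheory Filter Topology Set
open scoped ENNReal

namespace RandomMicromagnetics

/-- Three-dimensional Euclidean space. -/
abbrev E3 : Type := EuclideanSpace ℝ (Fin 3)

/-- The unit sphere of `ℝ³`. -/
abbrev S2 : Set E3 := Metric.sphere (0 : E3) 1

/-! ### The dynamical system -/

/-- A continuous, measure preserving, ergodic action `(T_x)` of `ℝ³` on the probability space
`(Ω, P)`. Measurability of `(x, ω) ↦ T_x ω` refers to the completion of the product measure (for a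
complete σ-algebra on `Ω` this is the only possible reading, since a product of complete
σ-algebras is not complete; for the Borel σ-algebra it follows from continuity). Each `T_x` is
automatically a bijection, with inverse `T_{-x}`. -/
structure IsErgodicSystem {Ω : Type*} [TopologicalSpace Ω] [MeasurableSpace Ω]
    (P : Measure Ω) (T : E3 → Ω → Ω) : Prop where
  map_zero : T 0 = id
  map_add : ∀ x y, T (x + y) = T x ∘ T y
  measurePreserving : ∀ x, MeasurePreserving (T x) P P
  nullMeasurable :
    NullMeasurable (fun p : E3 × Ω => T p.1 p.2) ((volume : Measure E3).prod P)
  continuous : Continuous (fun p : E3 × Ω => T p.1 p.2)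
  ergodic : ∀ A, MeasurableSet A → (∀ x, T x '' A =ᵐ[P] A) → P A = 0 ∨ P A = 1

/-! ### The function spaces `L²(D; S²)` and `H¹(D; S²)` -/

/-- `L²(D; ℝ³)`. -/
abbrev L2 (D : Set E3) : Type := Lp E3 2 (volume.restrict D)

/-- `L²(D; S²)`, with the topology of strong `L²` convergence. -/
def L2Sphere (D : Set E3) : Set (L2 D) := {m | ∀ᵐ x ∂(volume.restrict D), m x ∈ S2}

/-- `g` is the weak partial derivative of `u` in the direction of the `i`-th basis vector in the
open set `D`: `∫_D (∂_i ψ) u = - ∫_D ψ g` for all `ψ ∈ C_c^∞(D)`. -/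
def IsWeakPartialDeriv (D : Set E3) (i : Fin 3) (u g : L2 D) : Prop :=
  ∀ ψ : E3 → ℝ, ContDiff ℝ (⊤ : ℕ∞) ψ → HasCompactSupport ψ → tsupport ψ ⊆ D →
    ∫ x in D, (fderiv ℝ ψ x (EuclideanSpace.single i 1)) • u x = -∫ x in D, ψ x • g x

theorem integrable_smul_L2 {D : Set E3} {η : E3 → ℝ} (hη : Continuous η)
    (hc : HasCompactSupport η) (u : L2 D) :
    Integrable (fun x => η x • u x) (volume.restrict D) := by
  have h1 : MemLp η 2 (volume.restrict D) :=
    (hη.memLp_of_hasCompactSupport hc (μ := volume)).restrict D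
  exact memLp_one_iff_integrable.1 ((Lp.memLp u).smul (r := 1) h1)

theorem continuous_partial {ψ : E3 → ℝ} (hψ : ContDiff ℝ (⊤ : ℕ∞) ψ) (i : Fin 3) :
    Continuous (fun x => fderiv ℝ ψ x (EuclideanSpace.single i 1)) :=
  (hψ.continuous_fderiv (by simp)).clm_apply continuous_const

theorem hasCompactSupport_partial {ψ : E3 → ℝ} (hc : HasCompactSupport ψ) (i : Fin 3) :
    HasCompactSupport (fun x => fderiv ℝ ψ x (EuclideanSpace.single i 1)) :=
  hc.fderiv_apply (𝕜 := ℝ) (EuclideanSpace.single i 1)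

theorem integral_smul_add {D : Set E3} {η : E3 → ℝ} (hη : Continuous η)
    (hc : HasCompactSupport η) (u v : L2 D) :
    ∫ x in D, η x • (u + v) x = (∫ x in D, η x • u x) + ∫ x in D, η x • v x := by
  rw [← integral_add (integrable_smul_L2 hη hc u) (integrable_smul_L2 hη hc v)]
  refine integral_congr_ae ?_
  filter_upwards [Lp.coeFn_add u v] with x hx
  rw [hx, Pi.add_apply, smul_add]

theorem integral_smul_smul {D : Set E3} (η : E3 → ℝ) (c : ℝ) (u : L2 D) :
    ∫ x in D, η x • (c • u) x = c • ∫ x in D, η x • u x := by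
  rw [← integral_smul]
  refine integral_congr_ae ?_
  filter_upwards [Lp.coeFn_smul c u] with x hx
  simp [hx, smul_comm c]

theorem integral_smul_zero {D : Set E3} (η : E3 → ℝ) :
    ∫ x in D, η x • (0 : L2 D) x = 0 := by
  have h := integral_smul_smul η 0 (0 : L2 D)
  simpa using h

/-- The Sobolev space `H¹(D; ℝ³)`, realised as the space of all pairs `(u, (∂₁u, ∂₂u, ∂₃u))` of an
`L²` map and its `L²` weak partial derivatives; the norm inherited from the ambient Hilbert space
is `(‖u‖² + ∑ ‖∂_i u‖²)^{1/2}`. -/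
def H1 (D : Set E3) : Submodule ℝ (WithLp 2 (L2 D × PiLp 2 (fun _ : Fin 3 => L2 D))) where
  carrier := {w | ∀ i, IsWeakPartialDeriv D i w.fst (w.snd i)}
  add_mem' := by
    intro v w hv hw i ψ hψ hc hD
    have h1 := hv i ψ hψ hc hD
    have h2 := hw i ψ hψ hc hD
    rw [WithLp.add_fst, WithLp.add_snd, PiLp.add_apply,
      integral_smul_add (continuous_partial hψ i) (hasCompactSupport_partial hc i),
      integral_smul_add hψ.continuous hc, h1, h2, neg_add]
  zero_mem' := by
    intro i ψ hψ hc hD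
    rw [WithLp.zero_fst, WithLp.zero_snd, PiLp.zero_apply, integral_smul_zero, integral_smul_zero,
      neg_zero]
  smul_mem' := by
    intro c w hw i ψ hψ hc hD
    have h1 := hw i ψ hψ hc hD
    rw [WithLp.smul_fst, WithLp.smul_snd, PiLp.smul_apply, integral_smul_smul, integral_smul_smul,
      h1, smul_neg]

/-- The `L²` map underlying an element of `H¹(D; ℝ³)`, the latter carrying its weak topology. -/
noncomputable def H1.toL2 {D : Set E3} (w : WeakSpace ℝ (H1 D)) : L2 D :=
  (((toWeakSpace ℝ (H1 D)).symm w : H1 D) :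
    WithLp 2 (L2 D × PiLp 2 (fun _ : Fin 3 => L2 D))).fst

/-- `H¹(D; S²)`, with the weak topology of `H¹(D; ℝ³)`. -/
def H1Sphere (D : Set E3) : Set (WeakSpace ℝ (H1 D)) := {w | H1.toL2 w ∈ L2Sphere D}

/-! ### Continuous convergence -/

/-- The family `(F_ε)_{ε > 0}` converges continuously to `F₀` as `ε → 0`: for every `x` and every
neighbourhood `V` of `F₀ x` one has `F_ε y ∈ V` for all small `ε > 0` and all `y` near `x`. -/
def ConvergesContinuously {X : Type*} [TopologicalSpace X] (F : ℝ → X → ℝ) (F₀ : X → ℝ) : Prop :=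
  ∀ x, Tendsto (fun p : ℝ × X => F p.1 p.2) (𝓝[>] (0 : ℝ) ×ˢ 𝓝 x) (𝓝 (F₀ x))

/-- Sequential continuous convergence: `F_{ε_j} (x_j) → F₀ x` whenever `ε_j → 0`, `ε_j > 0`, and
`x_j → x`. (This is the notion in use for weak topologies, which are not first countable.) -/
def SeqConvergesContinuously {X : Type*} [TopologicalSpace X] (F : ℝ → X → ℝ) (F₀ : X → ℝ) :
    Prop :=
  ∀ (ε : ℕ → ℝ) (u : ℕ → X) (x : X), (∀ j, 0 < ε j) → Tendsto ε atTop (𝓝 0) →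
    Tendsto u atTop (𝓝 x) → Tendsto (fun j => F (ε j) (u j)) atTop (𝓝 (F₀ x))

/-! ### The energies -/

variable {Ω : Type*}

/-- The anisotropy energy density `x ↦ φ(T_{x/ε} ω, m(x))`. -/
noncomputable def anisotropyDensity {D : Set E3} (T : E3 → Ω → Ω) (φ : Ω → E3 → ℝ) (ω : Ω) (ε : ℝ) (m : L2 D) :
    E3 → ℝ :=
  fun x => φ (T (ε⁻¹ • x) ω) (m x)

/-- The Zeeman energy density `x ↦ h_a(x) · M_sat(T_{x/ε} ω) m(x)`. -/
noncomputable def zeemanDensity {D : Set E3} (T : E3 → Ω → Ω) (Msat : Ω → ℝ) (ha : E3 → E3) (ω : Ω)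
    (ε : ℝ) (m : L2 D) : E3 → ℝ :=
  fun x => inner ℝ (ha x) (Msat (T (ε⁻¹ • x) ω) • m x)

/-- The homogenized anisotropy density `x ↦ E[φ](m(x))`. -/
noncomputable def anisotropyDensityHom {D : Set E3} [MeasurableSpace Ω] (P : Measure Ω)
    (φ : Ω → E3 → ℝ) (m : L2 D) : E3 → ℝ :=
  fun x => ∫ ω, φ ω (m x) ∂P

/-- The homogenized Zeeman density `x ↦ h_a(x) · E[M_sat] m(x)`. -/
noncomputable def zeemanDensityHom {D : Set E3} [MeasurableSpace Ω] (P : Measure Ω) (Msat : Ω → ℝ)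
    (ha : E3 → E3) (m : L2 D) : E3 → ℝ :=
  fun x => inner ℝ (ha x) ((∫ ω, Msat ω ∂P) • m x)

/-- `A_ε(m) = ∫_D φ(T_{x/ε} ω, m(x)) dx`. -/
noncomputable def anisotropyEnergy {D : Set E3} (T : E3 → Ω → Ω) (φ : Ω → E3 → ℝ) (ω : Ω) (ε : ℝ)
    (m : L2 D) : ℝ :=
  ∫ x in D, anisotropyDensity T φ ω ε m x

/-- `Z_ε(m) = -μ₀ ∫_D h_a · M_sat(T_{x/ε} ω) m(x) dx`. -/
noncomputable def zeemanEnergy {D : Set E3} (T : E3 → Ω → Ω) (Msat : Ω → ℝ) (ha : E3 → E3) (μ₀ : ℝ)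
    (ω : Ω) (ε : ℝ) (m : L2 D) : ℝ :=
  -μ₀ * ∫ x in D, zeemanDensity T Msat ha ω ε m x

/-- `A_hom(m) = ∫_D E[φ](m(x)) dx`. -/
noncomputable def anisotropyEnergyHom {D : Set E3} [MeasurableSpace Ω] (P : Measure Ω)
    (φ : Ω → E3 → ℝ) (m : L2 D) : ℝ :=
  ∫ x in D, anisotropyDensityHom P φ m x

/-- `Z_hom(m) = -μ₀ ∫_D h_a · E[M_sat] m(x) dx`. -/
noncomputable def zeemanEnergyHom {D : Set E3} [MeasurableSpace Ω] (P : Measure Ω) (Msat : Ω → ℝ)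
    (ha : E3 → E3) (μ₀ : ℝ) (m : L2 D) : ℝ :=
  -μ₀ * ∫ x in D, zeemanDensityHom P Msat ha m x

/-- The anisotropy density `φ : Ω × S² → [0, ∞)`: `φ(·, s) ∈ L^∞(Ω)` for every `s ∈ S²`, and `φ(ω, ·)`
is Lipschitz on `S²` with a constant `L > 0` independent of `ω`. Values of `φ(ω, ·)` off the sphere
play no role. -/
structure IsAnisotropyDensity [MeasurableSpace Ω] (P : Measure Ω) (φ : Ω → E3 → ℝ) : Prop where
  memLp : ∀ s ∈ S2, MemLp (fun ω => φ ω s) ∞ P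
  nonneg : ∀ s ∈ S2, ∀ᵐ ω ∂P, 0 ≤ φ ω s
  lipschitz : ∃ L : ℝ, 0 < L ∧
    ∀ᵐ ω ∂P, ∀ s₁ ∈ S2, ∀ s₂ ∈ S2, |φ ω s₁ - φ ω s₂| ≤ L * ‖s₁ - s₂‖

/-- The saturation magnetization `M_sat ∈ L^∞(Ω)`, `M_sat ≥ 0`. -/
structure IsSaturation [MeasurableSpace Ω] (P : Measure Ω) (Msat : Ω → ℝ) : Prop where
  memLp : MemLp Msat ∞ P
  nonneg : ∀ᵐ ω ∂P, 0 ≤ Msat ω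

end RandomMicromagnetics

/-!
The theorem rests on a pointwise ergodic theorem in weak-* form: for `f ∈ L^∞(Ω)` and almost every
`ω`, the functions `x ↦ f (T_{x/ε} ω)` converge weakly-* in `L^∞(ℝ³)` to the constant `E[f]`
(`IsErgodicSystem.exists_ae_orbitConverges`). It is obtained as follows.

* For a coboundary `u - u ∘ T_y` convergence to `0` is elementary, since composing with `T_y`
  translates the test function by `ε y` (`IsErgodicSystem.vanishingAverages_sub_comp`).
* A function in `L²(Ω)` orthogonal to all coboundaries is invariant, hence constant by ergodicity, so
  a bounded function of mean zero is an `L²` limit of functions whose averages vanish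
  (`IsErgodicSystem.vanishingAverages_of_integral_eq_zero`).
* The passage to the limit uses a weak-type maximal inequality for the action
  (`IsErgodicSystem.measure_maximal_le`): the Hardy–Littlewood inequality, from the Vitali covering
  lemma, is applied along orbits and integrated over `Ω`.

The ergodic theorem is applied to `M_sat` and to `φ(·, s)` for `s` in a countable dense subset of the
sphere, which leaves a single null set. For such `ω` the rest is deterministic. The Zeeman energy
pairs a weakly-* convergent bounded function with `h_a · m`, which depends continuously in `L¹` on
`m ∈ L²`. In the anisotropy energy the Lipschitz bound allows `m` to be replaced, uniformly in `ε`,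
by a map with finitely many values in the dense set, for which weak-* convergence applies directly.

Weak convergence in `H¹(D; S²)` reduces to strong convergence in `L²` without a compact embedding:
all maps into the sphere have the same `L²(D)` norm, and weak convergence together with convergence
of the norms is strong convergence (`tendsto_toL2_of_tendsto`).
-/

namespace RandomMicromagnetics

/-! ### The maximal inequality -/

/-- The Hardy–Littlewood maximal inequality on a ball, for the radii `1, …, K`. The factor `5 ^ 3`
is the volume ratio in the Vitali covering lemma. -/
theorem volume_maximal_le (F : E3 → ℝ≥0∞) (lam : ℝ≥0∞) (N K : ℕ) :
    lam * volume {x : E3 | x ∈ Metric.closedBall 0 (N : ℝ) ∧ ∃ k : ℕ, 1 ≤ k ∧ k ≤ K ∧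
      lam * volume (Metric.closedBall (0 : E3) k) < ∫⁻ y in Metric.closedBall x k, F y} ≤
    125 * ∫⁻ y in Metric.closedBall (0 : E3) (N + K), F y := by
  set E := {x : E3 | x ∈ Metric.closedBall 0 (N : ℝ) ∧ ∃ k : ℕ, 1 ≤ k ∧ k ≤ K ∧
      lam * volume (Metric.closedBall (0 : E3) k) < ∫⁻ y in Metric.closedBall x k, F y} with hE
  choose! r h1 hK hr using fun x (hx : x ∈ E) => hx.2
  obtain ⟨u, huE, hdisj, hcov⟩ :=
    Vitali.exists_disjoint_subfamily_covering_enlargement_closedBall E id (fun x => (r x : ℝ)) K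
      (fun x hx => by exact_mod_cast hK x hx) 5 (by norm_num)
  have huc : u.Countable := hdisj.countable_of_nonempty_interior fun x hx =>
    ⟨x, mem_interior_iff_mem_nhds.2 (Metric.closedBall_mem_nhds x (by
      exact_mod_cast h1 x (huE hx)))⟩
  have hsub : E ⊆ ⋃ x ∈ u, Metric.closedBall x (5 * (r x : ℝ)) := by
    intro x hx
    obtain ⟨b, hb, hb'⟩ := hcov x hx
    exact mem_biUnion hb (hb' (Metric.mem_closedBall_self (by positivity)))
  calc lam * volume E
      ≤ lam * ∑' x : u, volume (Metric.closedBall (x : E3) (5 * (r x : ℝ))) :=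
        mul_le_mul_right ((measure_mono hsub).trans (measure_biUnion_le _ huc _)) _
    _ = 125 * ∑' x : u, lam * volume (Metric.closedBall (0 : E3) (r x)) := by
        rw [← ENNReal.tsum_mul_left, ← ENNReal.tsum_mul_left]
        refine tsum_congr fun x => ?_
        rw [Measure.addHaar_closedBall_mul _ _ (by norm_num) (by positivity)]
        rw [finrank_euclideanSpace_fin, mul_left_comm]
        norm_num
    _ ≤ 125 * ∑' x : u, ∫⁻ y in Metric.closedBall (x : E3) (r x), F y := by
        gcongr with x
        exact (hr x (huE x.2)).le
    _ = 125 * ∫⁻ y in ⋃ x ∈ u, Metric.closedBall x (r x : ℝ), F y := by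
        rw [lintegral_biUnion₀ (s := fun x => Metric.closedBall x (r x : ℝ)) huc
          (fun x _ => Metric.isClosed_closedBall.measurableSet.nullMeasurableSet)
          (fun x hx y hy hxy => (hdisj hx hy hxy).aedisjoint)]
    _ ≤ 125 * ∫⁻ y in Metric.closedBall (0 : E3) (N + K), F y := by
        gcongr
        refine iUnion₂_subset fun x hx => Metric.closedBall_subset_closedBall' ?_
        have h2 : dist x 0 ≤ N := (huE hx).1
        have h3 : (r x : ℝ) ≤ K := by exact_mod_cast hK x (huE hx)
        linarith

section MaximalInequality

variable {Ω : Type*} [TopologicalSpace Ω] [MeasurableSpace Ω] {P : Measure Ω}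
  {T : E3 → Ω → Ω}

theorem IsErgodicSystem.apply_add (hT : IsErgodicSystem P T) (x y : E3) (ω : Ω) :
    T (x + y) ω = T x (T y ω) := by
  rw [hT.map_add]; rfl

theorem IsErgodicSystem.apply_neg_apply (hT : IsErgodicSystem P T) (x : E3) (ω : Ω) :
    T (-x) (T x ω) = ω := by
  rw [← hT.apply_add, neg_add_cancel, hT.map_zero, id]

theorem IsErgodicSystem.aemeasurable_comp (hT : IsErgodicSystem P T) {β : Type*}
    [MeasurableSpace β] [MeasurableSpace.CountablyGenerated β] {v : Ω → β} (hv : Measurable v) :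
    AEMeasurable (fun p : E3 × Ω => v (T p.1 p.2)) ((volume : Measure E3).prod P) :=
  (hv.comp_nullMeasurable hT.nullMeasurable).aemeasurable

theorem IsErgodicSystem.aemeasurable_comp_restrict [SFinite P] (hT : IsErgodicSystem P T)
    {β : Type*} [MeasurableSpace β] [MeasurableSpace.CountablyGenerated β] {v : Ω → β}
    (hv : Measurable v) (B : Set E3) :
    AEMeasurable (fun p : E3 × Ω => v (T p.1 p.2)) ((volume.restrict B).prod P) :=
  (hT.aemeasurable_comp hv).mono_ac
    (Measure.absolutelyContinuous_of_le Measure.restrict_le_self |>.prod .rfl)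

/-- Tonelli's theorem for `(x, ω) ↦ v (T_x ω)`: the integral over `Ω` of an average along orbits. -/
theorem IsErgodicSystem.lintegral_orbit [SFinite P] (hT : IsErgodicSystem P T) {v : Ω → ℝ≥0∞}
    (hv : Measurable v) (B : Set E3) :
    ∫⁻ ω, (∫⁻ x in B, v (T x ω)) ∂P = volume B * ∫⁻ ω, v ω ∂P := by
  rw [← lintegral_lintegral_swap (hT.aemeasurable_comp_restrict hv B)]
  simp_rw [(hT.measurePreserving _).lintegral_comp hv]
  rw [lintegral_const, Measure.restrict_apply_univ, mul_comm]

/-- The maximal inequality for the action, restricted to the radii `1, …, K`; it is the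
Hardy–Littlewood inequality on the orbits, averaged over `Ω`. -/
theorem IsErgodicSystem.measure_maximal_le_nat [SFinite P] (hT : IsErgodicSystem P T)
    {v : Ω → ℝ≥0∞} (hv : Measurable v) (lam : ℝ≥0∞) (K : ℕ) :
    lam * P {ω | ∃ k : ℕ, 1 ≤ k ∧ k ≤ K ∧ lam * volume (Metric.closedBall (0 : E3) k) <
      ∫⁻ x in Metric.closedBall (0 : E3) k, v (T x ω)} ≤ 1000 * ∫⁻ ω, v ω ∂P := by
  set G := {ω | ∃ k : ℕ, 1 ≤ k ∧ k ≤ K ∧ lam * volume (Metric.closedBall (0 : E3) k) <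
      ∫⁻ x in Metric.closedBall (0 : E3) k, v (T x ω)} with hG
  rcases Nat.eq_zero_or_pos K with rfl | hKpos
  · have : G = ∅ := by
      ext ω; simp only [hG, mem_ofPred_eq, mem_empty_iff_false, iff_false]
      rintro ⟨k, h1, h2, -⟩; omega
    simp [this]
  have hGm : NullMeasurableSet G P := by
    have : G = ⋃ k : ℕ, ⋃ _ : 1 ≤ k, ⋃ _ : k ≤ K,
        {ω | lam * volume (Metric.closedBall (0 : E3) k) <
          ∫⁻ x in Metric.closedBall (0 : E3) k, v (T x ω)} := by
      ext ω; simp only [hG, mem_ofPred_eq, mem_iUnion, exists_prop]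
    rw [this]
    refine .iUnion fun k => .iUnion fun _ => .iUnion fun _ => ?_
    exact nullMeasurableSet_lt aemeasurable_const
      (hT.aemeasurable_comp_restrict hv _).lintegral_prod_left'
  obtain ⟨G', hG'G, hG'm, hG'e⟩ := hGm.exists_measurable_subset_ae_eq
  set B := Metric.closedBall (0 : E3) K with hB
  have hB0 : volume B ≠ 0 := (Metric.measure_closedBall_pos _ _ (by exact_mod_cast hKpos)).ne'
  have hBt : volume B ≠ ∞ := (isCompact_closedBall _ _).measure_lt_top.ne
  -- The starting points fill a ball of radius `K`, the orbits one of radius `2 K`: this costs a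
  -- factor `2 ^ 3 = 8` on top of the Vitali constant `125`.
  have key : volume B * (lam * P G) ≤ volume B * (1000 * ∫⁻ ω, v ω ∂P) := by
    calc volume B * (lam * P G)
        = lam * (volume B * ∫⁻ ω, G'.indicator 1 ω ∂P) := by
          rw [lintegral_indicator_one hG'm, measure_congr hG'e]; ring
      _ = lam * ∫⁻ ω, (∫⁻ x in B, G'.indicator 1 (T x ω)) ∂P := by
          rw [hT.lintegral_orbit (measurable_one.indicator hG'm)]
      _ ≤ ∫⁻ ω, (lam * ∫⁻ x in B, G'.indicator 1 (T x ω)) ∂P := lintegral_const_mul_le _ _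
      _ ≤ ∫⁻ ω, (125 * ∫⁻ y in Metric.closedBall (0 : E3) (K + K), v (T y ω)) ∂P := by
          refine lintegral_mono fun ω => le_trans ?_ (volume_maximal_le _ lam K K)
          refine mul_le_mul_right ?_ _
          calc ∫⁻ x in B, G'.indicator 1 (T x ω)
              = ∫⁻ x in B, ((fun x => T x ω) ⁻¹' G').indicator 1 x := rfl
            _ ≤ volume.restrict B ((fun x => T x ω) ⁻¹' G') := lintegral_indicator_one_le _
            _ = volume (((fun x => T x ω) ⁻¹' G') ∩ B) :=
                Measure.restrict_apply' Metric.isClosed_closedBall.measurableSet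
            _ ≤ _ := by
                refine measure_mono fun x hx => ⟨hx.2, ?_⟩
                obtain ⟨k, h1, h2, h3⟩ := hG'G hx.1
                refine ⟨k, h1, h2, h3.trans_eq ?_⟩
                -- The average at `T_x ω` is the average along the orbit of `ω` around `x`.
                have := (measurePreserving_add_right (volume : Measure E3) x).setLIntegral_comp_emb
                  (measurableEmbedding_addRight x) (fun y => v (T y ω))
                  (Metric.closedBall 0 (k : ℝ))
                simp only [hT.apply_add] at this
                rw [this]
                congr 2
                ext y
                simp [dist_eq_norm, ← sub_eq_add_neg]
      _ = 125 * (volume (Metric.closedBall (0 : E3) (2 * K)) * ∫⁻ ω, v ω ∂P) := by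
          rw [lintegral_const_mul' _ _ (by norm_num), hT.lintegral_orbit hv, two_mul]
      _ = volume B * (1000 * ∫⁻ ω, v ω ∂P) := by
          rw [Measure.addHaar_closedBall_mul _ _ (by norm_num) (by positivity),
            finrank_euclideanSpace_fin, show ENNReal.ofReal (2 ^ 3) = 8 by norm_num,
            show (1000 : ℝ≥0∞) = 125 * 8 by norm_num]
          ring
  exact (ENNReal.mul_le_mul_iff_right hB0 hBt).1 key

/-- The maximal inequality for the action: a weak-type bound for the maximal function over the
integer radii. -/
theorem IsErgodicSystem.measure_maximal_le [SFinite P] (hT : IsErgodicSystem P T)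
    {v : Ω → ℝ≥0∞} (hv : Measurable v) (lam : ℝ≥0∞) :
    lam * P {ω | ∃ k : ℕ, 1 ≤ k ∧ lam * volume (Metric.closedBall (0 : E3) k) <
      ∫⁻ x in Metric.closedBall (0 : E3) k, v (T x ω)} ≤ 1000 * ∫⁻ ω, v ω ∂P := by
  set G : ℕ → Set Ω := fun K => {ω | ∃ k : ℕ, 1 ≤ k ∧ k ≤ K ∧
    lam * volume (Metric.closedBall (0 : E3) k) <
      ∫⁻ x in Metric.closedBall (0 : E3) k, v (T x ω)} with hG
  have hmono : Monotone G := fun a b hab ω ⟨k, h1, h2, h3⟩ => ⟨k, h1, h2.trans hab, h3⟩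
  have hU : {ω | ∃ k : ℕ, 1 ≤ k ∧ lam * volume (Metric.closedBall (0 : E3) k) <
      ∫⁻ x in Metric.closedBall (0 : E3) k, v (T x ω)} = ⋃ K, G K := by
    ext ω
    simp only [hG, mem_ofPred_eq, mem_iUnion]
    exact ⟨fun ⟨k, h1, h3⟩ => ⟨k, k, h1, le_rfl, h3⟩, fun ⟨_, k, h1, _, h3⟩ => ⟨k, h1, h3⟩⟩
  rw [hU, hmono.measure_iUnion, ENNReal.mul_iSup]
  exact iSup_le fun K => hT.measure_maximal_le_nat hv lam K

end MaximalInequality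

/-! ### Oscillating averages along orbits -/

section Orbit

theorem aestronglyMeasurable_comp_inv_smul {F : E3 → ℝ} (hF : AEStronglyMeasurable F volume)
    {ε : ℝ} (hε : 0 < ε) : AEStronglyMeasurable (fun x => F (ε⁻¹ • x)) volume :=
  hF.comp_quasiMeasurePreserving
    (Measure.quasiMeasurePreserving_smul volume (inv_ne_zero hε.ne'))

variable {Ω : Type*} {T : E3 → Ω → Ω}

theorem integrable_orbit_mul {u : Ω → ℝ} {ω : Ω} {C : ℝ} (hC : ∀ ω, |u ω| ≤ C)
    (hF : AEStronglyMeasurable (fun x => u (T x ω)) volume) {g : E3 → ℝ} (hg : Integrable g)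
    {ε : ℝ} (hε : 0 < ε) : Integrable (fun x => u (T (ε⁻¹ • x) ω) * g x) :=
  hg.bdd_mul (c := C) (aestronglyMeasurable_comp_inv_smul hF hε)
    (Eventually.of_forall fun _ => hC _)

variable [MeasurableSpace Ω] {P : Measure Ω}

/-- `u` is a bounded measurable function whose oscillating orbit functions `x ↦ u (T_{x/ε} ω)`
vanish, for almost every `ω`, in the sense of measures as `ε → 0`. -/
structure VanishingAverages (P : Measure Ω) (T : E3 → Ω → Ω) (u : Ω → ℝ) : Prop where
  measurable : Measurable u
  bounded : ∃ C, ∀ ω, |u ω| ≤ C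
  tendsto : ∀ᵐ ω ∂P, ∀ g : E3 → ℝ, Continuous g → HasCompactSupport g →
    Tendsto (fun ε : ℝ => ∫ x, u (T (ε⁻¹ • x) ω) * g x) (𝓝[>] 0) (𝓝 0)

theorem VanishingAverages.const_smul (c : ℝ) {u : Ω → ℝ} (hu : VanishingAverages P T u) :
    VanishingAverages P T (c • u) := by
  obtain ⟨C, hC⟩ := hu.bounded
  refine ⟨hu.measurable.const_smul c, ⟨|c| * C, fun ω => ?_⟩, ?_⟩
  · rw [Pi.smul_apply, smul_eq_mul, abs_mul]
    exact mul_le_mul_of_nonneg_left (hC ω) (abs_nonneg c)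
  · filter_upwards [hu.tendsto] with ω h1 g hg hgc
    simpa [mul_assoc, integral_const_mul] using (h1 g hg hgc).const_mul c

theorem vanishingAverages_zero : VanishingAverages P T (0 : Ω → ℝ) :=
  ⟨measurable_zero, ⟨0, by simp⟩, by simp⟩

variable [TopologicalSpace Ω]

theorem IsErgodicSystem.ae_orbit_aestronglyMeasurable [SFinite P] (hT : IsErgodicSystem P T)
    {u : Ω → ℝ} (hu : Measurable u) :
    ∀ᵐ ω ∂P, AEStronglyMeasurable (fun x => u (T x ω)) volume :=
  (hT.aemeasurable_comp hu).aestronglyMeasurable.prod_swap.prodMk_left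

theorem VanishingAverages.add [SFinite P] (hT : IsErgodicSystem P T) {u v : Ω → ℝ}
    (hu : VanishingAverages P T u) (hv : VanishingAverages P T v) :
    VanishingAverages P T (u + v) := by
  obtain ⟨C, hC⟩ := hu.bounded
  obtain ⟨C', hC'⟩ := hv.bounded
  refine ⟨hu.measurable.add hv.measurable, ⟨C + C', fun ω => ?_⟩, ?_⟩
  · exact (abs_add_le _ _).trans (add_le_add (hC ω) (hC' ω))
  · filter_upwards [hu.tendsto, hv.tendsto, hT.ae_orbit_aestronglyMeasurable hu.measurable,
      hT.ae_orbit_aestronglyMeasurable hv.measurable] with ω h1 h2 h3 h4 g hg hgc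
    have := (h1 g hg hgc).add (h2 g hg hgc)
    rw [add_zero] at this
    refine this.congr' ?_
    filter_upwards [self_mem_nhdsWithin] with ε hε
    have hgi := hg.integrable_of_hasCompactSupport hgc (μ := volume)
    rw [← integral_add (integrable_orbit_mul hC h3 hgi hε) (integrable_orbit_mul hC' h4 hgi hε)]
    simp only [Pi.add_apply, add_mul]

theorem tendsto_integral_abs_sub_translate {g : E3 → ℝ} (hg : Continuous g)
    (hgc : HasCompactSupport g) (y : E3) :
    Tendsto (fun ε : ℝ => ∫ x, |g x - g (x - ε • y)|) (𝓝[>] 0) (𝓝 0) := by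
  obtain ⟨M, hM⟩ := hgc.exists_bound_of_continuous hg
  obtain ⟨R, hR⟩ := hgc.isCompact.isBounded.subset_closedBall 0
  have hzero : ∀ x, R < ‖x‖ → g x = 0 := fun x hx => by
    by_contra h
    have := hR (subset_tsupport g h)
    rw [mem_closedBall_zero_iff] at this
    linarith
  have key := tendsto_integral_filter_of_dominated_convergence (μ := (volume : Measure E3))
    (l := 𝓝[>] (0 : ℝ)) (F := fun ε x => |g x - g (x - ε • y)|) (f := fun _ => 0)
    ((Metric.closedBall (0 : E3) (R + ‖y‖)).indicator fun _ => M + M)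
    (Eventually.of_forall fun ε => by
      exact (Continuous.abs (by fun_prop)).aestronglyMeasurable) ?_ ?_ ?_
  · simpa using key
  · filter_upwards [Ioo_mem_nhdsGT (zero_lt_one' ℝ)] with ε hε
    refine Eventually.of_forall fun x => ?_
    have hMx := fun x => (norm_nonneg (g x)).trans (hM x)
    by_cases hx : x ∈ Metric.closedBall (0 : E3) (R + ‖y‖)
    · rw [indicator_of_mem hx, Real.norm_eq_abs, abs_abs]
      exact (abs_sub _ _).trans (add_le_add (hM _) (hM _))
    · rw [mem_closedBall_zero_iff, not_le] at hx
      have h1 : g x = 0 := hzero x (by linarith [norm_nonneg y])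
      have h2 : g (x - ε • y) = 0 := by
        refine hzero _ ?_
        have h3 := norm_sub_norm_le x (ε • y)
        have h4 : ‖ε • y‖ ≤ ‖y‖ := by
          rw [norm_smul, Real.norm_of_nonneg hε.1.le]
          exact mul_le_of_le_one_left (norm_nonneg _) hε.2.le
        linarith
      rw [h1, h2]
      simpa using indicator_nonneg (fun x _ => add_nonneg (hMx x) (hMx x)) x
  · exact (integrable_indicator_iff Metric.isClosed_closedBall.measurableSet).2
      (integrableOn_const (isCompact_closedBall _ _).measure_lt_top.ne)
  · refine Eventually.of_forall fun x => ?_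
    have : Continuous fun ε : ℝ => |g x - g (x - ε • y)| := by fun_prop
    simpa using (this.tendsto 0).mono_left nhdsWithin_le_nhds

/-- Coboundaries have vanishing averages: replacing `u` by `u ∘ T_y` amounts to translating the
test function by `ε y`. -/
theorem IsErgodicSystem.vanishingAverages_sub_comp [SFinite P] (hT : IsErgodicSystem P T)
    {u : Ω → ℝ} (hu : Measurable u) (hb : ∃ C, ∀ ω, |u ω| ≤ C) (y : E3) :
    VanishingAverages P T (u - u ∘ T y) := by
  obtain ⟨C, hC⟩ := hb
  have hm : Measurable (u ∘ T y) := hu.comp (hT.measurePreserving y).measurable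
  refine ⟨hu.sub hm, ⟨C + C, fun ω => (abs_sub _ _).trans (add_le_add (hC _) (hC _))⟩, ?_⟩
  filter_upwards [hT.ae_orbit_aestronglyMeasurable hu,
    hT.ae_orbit_aestronglyMeasurable hm] with ω h1 h2 g hg hgc
  have hgi := hg.integrable_of_hasCompactSupport hgc (μ := volume)
  have hlim := (tendsto_integral_abs_sub_translate hg hgc y).const_mul C
  rw [mul_zero] at hlim
  refine squeeze_zero_norm' ?_ hlim
  filter_upwards [self_mem_nhdsWithin] with ε (hε : 0 < ε)
  have e1 : ∫ x, u (T y (T (ε⁻¹ • x) ω)) * g x = ∫ x, u (T (ε⁻¹ • x) ω) * g (x - ε • y) := by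
    rw [← integral_add_right_eq_self (fun x => u (T (ε⁻¹ • x) ω) * g (x - ε • y)) (ε • y)]
    refine integral_congr_ae (Eventually.of_forall fun x => ?_)
    simp only
    rw [add_sub_cancel_right, ← hT.apply_add, smul_add, smul_smul, inv_mul_cancel₀ hε.ne',
      one_smul, add_comm]
  have e2 : ∫ x, (u - u ∘ T y) (T (ε⁻¹ • x) ω) * g x =
      ∫ x, u (T (ε⁻¹ • x) ω) * (g x - g (x - ε • y)) := by
    simp only [Pi.sub_apply, sub_mul, mul_sub, Function.comp]
    rw [integral_sub (integrable_orbit_mul hC h1 hgi hε)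
      (integrable_orbit_mul (fun ω => hC (T y ω)) h2 hgi hε),
      integral_sub (integrable_orbit_mul hC h1 hgi hε)
      (integrable_orbit_mul hC h1 (hgi.comp_sub_right (ε • y)) hε), e1]
  rw [e2, ← integral_const_mul]
  refine norm_integral_le_of_norm_le
    ((hgi.sub (hgi.comp_sub_right (ε • y))).abs.const_mul C) (Eventually.of_forall fun x => ?_)
  rw [norm_mul]
  exact mul_le_mul_of_nonneg_right (hC _) (norm_nonneg _)

/-- Rescaling of a bound on the averages over the balls of integer radius. Rounding `R / ε` up to
an integer enlarges the ball of radius `R` to one of radius at most `R + ε`. -/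
theorem lintegral_comp_inv_smul_le {F : E3 → ℝ≥0∞} {lam : ℝ≥0∞}
    (hF : ∀ k : ℕ, 1 ≤ k → ∫⁻ x in Metric.closedBall (0 : E3) k, F x ≤
      lam * volume (Metric.closedBall (0 : E3) k)) {R ε : ℝ} (hR : 0 < R) (hε : 0 < ε)
    (hε1 : ε ≤ 1) :
    ∫⁻ x in Metric.closedBall (0 : E3) R, F (ε⁻¹ • x) ≤
      lam * volume (Metric.closedBall (0 : E3) (R + 1)) := by
  have hemb : MeasurableEmbedding (fun x : E3 => ε⁻¹ • x) :=
    measurableEmbedding_const_smul₀ (inv_ne_zero hε.ne')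
  have hpre : Metric.closedBall (0 : E3) R =
      (fun x : E3 => ε⁻¹ • x) ⁻¹' Metric.closedBall (0 : E3) (R / ε) := by
    ext x
    simp only [mem_preimage, mem_closedBall_zero_iff, norm_smul, norm_inv,
      Real.norm_of_nonneg hε.le]
    rw [inv_mul_eq_div, div_le_div_iff_of_pos_right hε]
  set k := ⌈R / ε⌉₊ with hk
  have hk1 : 1 ≤ k := Nat.one_le_iff_ne_zero.2 (Nat.ceil_pos.2 (by positivity)).ne'
  have hkR : ε * k ≤ R + 1 := by
    have := (Nat.ceil_lt_add_one (div_nonneg hR.le hε.le)).le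
    calc ε * k ≤ ε * (R / ε + 1) := by gcongr
      _ = R + ε := by field_simp
      _ ≤ R + 1 := by linarith
  calc ∫⁻ x in Metric.closedBall (0 : E3) R, F (ε⁻¹ • x)
      = ∫⁻ x in Metric.closedBall (0 : E3) (R / ε), F x
          ∂(Measure.map (fun x : E3 => ε⁻¹ • x) volume) := by
        rw [hemb.restrict_map, hemb.lintegral_map, ← hpre]
    _ = ENNReal.ofReal (ε ^ 3) * ∫⁻ x in Metric.closedBall (0 : E3) (R / ε), F x := by
        rw [Measure.map_addHaar_smul _ (inv_ne_zero hε.ne'), Measure.restrict_smul,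
          lintegral_smul_measure, finrank_euclideanSpace_fin, inv_pow, inv_inv,
          abs_of_pos (by positivity), smul_eq_mul]
    _ ≤ ENNReal.ofReal (ε ^ 3) * ∫⁻ x in Metric.closedBall (0 : E3) k, F x := by
        gcongr
        exact Nat.le_ceil _
    _ ≤ ENNReal.ofReal (ε ^ 3) * (lam * volume (Metric.closedBall (0 : E3) k)) := by
        gcongr
        exact hF k hk1
    _ = lam * volume (Metric.closedBall (0 : E3) (ε * k)) := by
        rw [Measure.addHaar_closedBall_mul _ _ hε.le (by positivity), finrank_euclideanSpace_fin,
          mul_left_comm]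
    _ ≤ lam * volume (Metric.closedBall (0 : E3) (R + 1)) := by
        gcongr

/-- Almost every `ω` is controlled, at every level `lam`, by one of a family of functions with
arbitrarily small `L¹` norm; this is the maximal inequality. -/
theorem IsErgodicSystem.ae_forall_exists_averages_le [SFinite P] (hT : IsErgodicSystem P T)
    {v : ℕ → Ω → ℝ≥0∞} (hv : ∀ n, Measurable (v n))
    (hlim : Tendsto (fun n => ∫⁻ ω, v n ω ∂P) atTop (𝓝 0)) :
    ∀ᵐ ω ∂P, ∀ j : ℕ, ∃ n, ∀ k : ℕ, 1 ≤ k → ∫⁻ x in Metric.closedBall (0 : E3) k, v n (T x ω) ≤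
      ((j : ℝ≥0∞) + 1)⁻¹ * volume (Metric.closedBall (0 : E3) k) := by
  rw [ae_all_iff]
  intro j
  set lam : ℝ≥0∞ := ((j : ℝ≥0∞) + 1)⁻¹ with hlam
  have hlam0 : lam ≠ 0 := by
    rw [hlam, Ne, ENNReal.inv_eq_zero]; exact_mod_cast ENNReal.natCast_ne_top (j + 1)
  rw [ae_iff]
  have hle : ∀ n, lam * P {ω | ¬∃ n, ∀ k : ℕ, 1 ≤ k →
      ∫⁻ x in Metric.closedBall (0 : E3) k, v n (T x ω) ≤
        lam * volume (Metric.closedBall (0 : E3) k)} ≤ 1000 * ∫⁻ ω, v n ω ∂P := by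
    intro n
    refine le_trans (mul_le_mul_right (measure_mono fun ω hω => ?_) _)
      (hT.measure_maximal_le (hv n) lam)
    simp only [mem_ofPred_eq, not_exists, not_forall, not_le] at hω
    obtain ⟨k, hk, h⟩ := hω n
    exact ⟨k, hk, h⟩
  have hlim' := ENNReal.Tendsto.const_mul (a := 1000) hlim (Or.inr (by norm_num))
  rw [mul_zero] at hlim'
  have := le_antisymm (ge_of_tendsto' hlim' hle) zero_le
  exact (mul_eq_zero.1 this).resolve_left hlam0

/-- Bounded `L¹` limits of functions with vanishing averages have vanishing averages. -/
theorem IsErgodicSystem.vanishingAverages_of_tendsto [SFinite P] (hT : IsErgodicSystem P T)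
    {w : Ω → ℝ} (hw : Measurable w) (hb : ∃ C, ∀ ω, |w ω| ≤ C) {u : ℕ → Ω → ℝ}
    (hu : ∀ n, VanishingAverages P T (u n))
    (hlim : Tendsto (fun n => ∫⁻ ω, ‖w ω - u n ω‖ₑ ∂P) atTop (𝓝 0)) :
    VanishingAverages P T w := by
  refine ⟨hw, hb, ?_⟩
  obtain ⟨C, hC⟩ := hb
  filter_upwards [hT.ae_orbit_aestronglyMeasurable hw,
    ae_all_iff.2 fun n => hT.ae_orbit_aestronglyMeasurable (hu n).measurable,
    ae_all_iff.2 fun n => (hu n).tendsto,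
    hT.ae_forall_exists_averages_le (v := fun n ω => ‖w ω - u n ω‖ₑ)
      (fun n => (hw.sub (hu n).measurable).enorm) hlim] with ω h1 h2 h3 h4 g hg hgc
  have hgi := hg.integrable_of_hasCompactSupport hgc (μ := volume)
  obtain ⟨M, hM⟩ := hgc.exists_bound_of_continuous hg
  obtain ⟨R, hR0, hR⟩ := hgc.isCompact.isBounded.subset_closedBall_lt 0 0
  set V := volume (Metric.closedBall (0 : E3) (R + 1)) with hV
  have hVt : V ≠ ∞ := (isCompact_closedBall _ _).measure_lt_top.ne
  rw [Metric.tendsto_nhds]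
  intro η hη
  have hj : Tendsto (fun j : ℕ => ENNReal.ofReal M * (((j : ℝ≥0∞) + 1)⁻¹ * V)) atTop (𝓝 0) := by
    have h : Tendsto (fun j : ℕ => ((j : ℝ≥0∞) + 1)⁻¹) atTop (𝓝 0) := by
      have := (tendsto_add_atTop_iff_nat 1).2 ENNReal.tendsto_inv_nat_nhds_zero
      simpa using this
    have := ENNReal.Tendsto.const_mul (a := ENNReal.ofReal M)
      (ENNReal.Tendsto.mul_const (b := V) h (Or.inr hVt)) (Or.inr ENNReal.ofReal_ne_top)
    simpa using this
  obtain ⟨j, hj⟩ := (hj.eventually (gt_mem_nhds (ENNReal.ofReal_pos.2 (half_pos hη)))).exists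
  obtain ⟨n, hn⟩ := h4 j
  obtain ⟨C', hC'⟩ := (hu n).bounded
  filter_upwards [(Metric.tendsto_nhds.1 (h3 n g hg hgc)) (η / 2) (half_pos hη),
    Ioo_mem_nhdsGT (zero_lt_one' ℝ)] with ε hε1 hε
  have hsplit : ∫ x, w (T (ε⁻¹ • x) ω) * g x =
      (∫ x, (w (T (ε⁻¹ • x) ω) - u n (T (ε⁻¹ • x) ω)) * g x) +
        ∫ x, u n (T (ε⁻¹ • x) ω) * g x := by
    simp only [sub_mul]
    rw [integral_sub (integrable_orbit_mul hC h1 hgi hε.1)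
      (integrable_orbit_mul hC' (h2 n) hgi hε.1), sub_add_cancel]
  have hsmall : ‖∫ x, (w (T (ε⁻¹ • x) ω) - u n (T (ε⁻¹ • x) ω)) * g x‖ₑ <
      ENNReal.ofReal (η / 2) := by
    refine lt_of_le_of_lt ?_ hj
    calc ‖∫ x, (w (T (ε⁻¹ • x) ω) - u n (T (ε⁻¹ • x) ω)) * g x‖ₑ
        ≤ ∫⁻ x, ‖(w (T (ε⁻¹ • x) ω) - u n (T (ε⁻¹ • x) ω)) * g x‖ₑ :=
          enorm_integral_le_lintegral_enorm _
      _ ≤ ∫⁻ x, (Metric.closedBall (0 : E3) R).indicator (fun x => ENNReal.ofReal M *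
            ‖w (T (ε⁻¹ • x) ω) - u n (T (ε⁻¹ • x) ω)‖ₑ) x := by
          refine lintegral_mono fun x => ?_
          by_cases hx : x ∈ Metric.closedBall (0 : E3) R
          · rw [indicator_of_mem hx, enorm_mul, mul_comm]
            gcongr
            rw [← ofReal_norm]
            exact ENNReal.ofReal_le_ofReal (hM x)
          · have : g x = 0 := by
              by_contra h
              exact hx (hR (subset_tsupport g h))
            simp [this]
      _ = ENNReal.ofReal M * ∫⁻ x in Metric.closedBall (0 : E3) R,
            ‖w (T (ε⁻¹ • x) ω) - u n (T (ε⁻¹ • x) ω)‖ₑ := by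
          rw [lintegral_indicator Metric.isClosed_closedBall.measurableSet,
            lintegral_const_mul' _ _ ENNReal.ofReal_ne_top]
      _ ≤ ENNReal.ofReal M * (((j : ℝ≥0∞) + 1)⁻¹ * V) := by
          refine mul_le_mul_right ?_ _
          exact lintegral_comp_inv_smul_le (F := fun x => ‖w (T x ω) - u n (T x ω)‖ₑ) hn hR0
            hε.1 hε.2.le
  rw [← ofReal_norm, ENNReal.ofReal_lt_ofReal_iff (half_pos hη)] at hsmall
  rw [dist_zero_right] at hε1 ⊢
  rw [hsplit]
  exact (norm_add_le _ _).trans_lt (by linarith)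

end Orbit

/-! ### The pointwise ergodic theorem -/

section ErgodicTheorem

variable {Ω : Type*} {T : E3 → Ω → Ω}

/-- The oscillating functions `x ↦ f (T_{x/ε} ω)` are measurable, bounded by `C`, and converge
weakly-* in `L^∞(ℝ³)` to the constant `c` as `ε → 0`. -/
structure OrbitConverges (T : E3 → Ω → Ω) (f : Ω → ℝ) (ω : Ω) (C c : ℝ) : Prop where
  aestronglyMeasurable : ∀ ε : ℝ, 0 < ε →
    AEStronglyMeasurable (fun x => f (T (ε⁻¹ • x) ω)) volume
  bound : ∀ ε : ℝ, 0 < ε → ∀ᵐ x, |f (T (ε⁻¹ • x) ω)| ≤ C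
  tendsto : ∀ g : E3 → ℝ, Integrable g →
    Tendsto (fun ε : ℝ => ∫ x, f (T (ε⁻¹ • x) ω) * g x) (𝓝[>] 0) (𝓝 (c * ∫ x, g x))

/-- For bounded functions, convergence against compactly supported continuous test functions extends to
all integrable ones, by density in `L¹`. -/
theorem tendsto_orbit_of_compactSupport {f : Ω → ℝ} {ω : Ω} {C c : ℝ} (hC : ∀ ω, |f ω| ≤ C)
    (hm : AEStronglyMeasurable (fun x => f (T x ω)) volume)
    (h : ∀ g : E3 → ℝ, Continuous g → HasCompactSupport g →
      Tendsto (fun ε : ℝ => ∫ x, f (T (ε⁻¹ • x) ω) * g x) (𝓝[>] 0) (𝓝 (c * ∫ x, g x)))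
    (g : E3 → ℝ) (hg : Integrable g) :
    Tendsto (fun ε : ℝ => ∫ x, f (T (ε⁻¹ • x) ω) * g x) (𝓝[>] 0) (𝓝 (c * ∫ x, g x)) := by
  have hC0 : 0 ≤ C := (abs_nonneg _).trans (hC ω)
  rw [Metric.tendsto_nhds]
  intro η hη
  set δ := η / (2 * (C + |c| + 1)) with hδ
  have hK : 0 < C + |c| + 1 := by positivity
  obtain ⟨g', hg'c, hg'd, hg', hg'i⟩ := hg.exists_hasCompactSupport_integral_sub_le
    (show 0 < δ by positivity)
  filter_upwards [Metric.tendsto_nhds.1 (h g' hg' hg'c) (η / 2) (half_pos hη),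
    self_mem_nhdsWithin] with ε h1 (hε : 0 < ε)
  have h2 : |(∫ x, f (T (ε⁻¹ • x) ω) * g x) - ∫ x, f (T (ε⁻¹ • x) ω) * g' x| ≤ C * δ := by
    rw [← integral_sub (integrable_orbit_mul hC hm hg hε) (integrable_orbit_mul hC hm hg'i hε)]
    rw [← Real.norm_eq_abs]
    calc ‖∫ x, (f (T (ε⁻¹ • x) ω) * g x - f (T (ε⁻¹ • x) ω) * g' x)‖
        ≤ ∫ x, C * ‖g x - g' x‖ := by
          refine norm_integral_le_of_norm_le
            ((hg.sub hg'i).norm.const_mul C) (Eventually.of_forall fun x => ?_)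
          rw [← mul_sub, norm_mul]
          exact mul_le_mul_of_nonneg_right (hC _) (norm_nonneg _)
      _ ≤ C * δ := by
          rw [integral_const_mul]
          exact mul_le_mul_of_nonneg_left hg'd hC0
  have h3 : |c * (∫ x, g' x) - c * ∫ x, g x| ≤ |c| * δ := by
    rw [← mul_sub, abs_mul, abs_sub_comm, ← integral_sub hg hg'i,
      ← Real.norm_eq_abs (∫ _, _)]
    exact mul_le_mul_of_nonneg_left ((norm_integral_le_integral_norm _).trans hg'd)
      (abs_nonneg c)
  have h4 : C * δ + |c| * δ < η / 2 := by
    have : (C + |c| + 1) * δ = η / 2 := by rw [hδ]; field_simp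
    have : 0 < δ := by positivity
    linarith
  rw [Real.dist_eq] at h1 ⊢
  rw [abs_lt] at *
  rw [abs_le] at h2 h3
  constructor <;> linarith [h1.1, h1.2, h2.1, h2.2, h3.1, h3.2]

variable [MeasurableSpace Ω] {P : Measure Ω}

theorem memLp_of_measurable_of_bounded [IsFiniteMeasure P] {u : Ω → ℝ} (hu : Measurable u)
    (hb : ∃ C, ∀ ω, |u ω| ≤ C) (p : ℝ≥0∞) : MemLp u p P :=
  let ⟨C, hC⟩ := hb
  .of_bound hu.aestronglyMeasurable C (Eventually.of_forall hC)

variable [TopologicalSpace Ω]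

theorem IsErgodicSystem.image_eq_preimage (hT : IsErgodicSystem P T) (x : E3) (A : Set Ω) :
    T x '' A = T (-x) ⁻¹' A := by
  ext ω
  constructor
  · rintro ⟨ω', h, rfl⟩
    rwa [mem_preimage, hT.apply_neg_apply]
  · intro h
    exact ⟨T (-x) ω, h, by simpa using hT.apply_neg_apply (-x) ω⟩

/-- Invariant functions are constant. -/
theorem IsErgodicSystem.ae_eq_const [IsProbabilityMeasure P] (hT : IsErgodicSystem P T)
    {v : Ω → ℝ} (hv : Measurable v) (hinv : ∀ y, v ∘ T y =ᵐ[P] v) :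
    ∃ c : ℝ, v =ᵐ[P] fun _ => c := by
  refine exists_eventuallyEq_const_of_forall_separating MeasurableSet fun U hU => ?_
  have hm : MeasurableSet (v ⁻¹' U) := hv hU
  rcases hT.ergodic (v ⁻¹' U) hm (fun x => by
    rw [hT.image_eq_preimage]
    filter_upwards [hinv (-x)] with ω hω
    exact congrArg (fun a => a ∈ U) hω) with h | h
  · exact Or.inr (measure_eq_zero_iff_ae_notMem.1 h)
  · exact Or.inl ((prob_compl_eq_zero_iff hm).2 h)

/-- The square integrable functions that agree almost everywhere with a function with vanishing
averages. -/
def IsErgodicSystem.vanishingSubmodule [SFinite P] (hT : IsErgodicSystem P T) :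
    Submodule ℝ (Lp ℝ 2 P) where
  carrier := {v | ∃ u, VanishingAverages P T u ∧ v =ᵐ[P] u}
  add_mem' := by
    rintro v w ⟨u, hu, h⟩ ⟨u', hu', h'⟩
    exact ⟨u + u', hu.add hT hu', (Lp.coeFn_add v w).trans (h.add h')⟩
  zero_mem' := ⟨0, vanishingAverages_zero, Lp.coeFn_zero _ _ _⟩
  smul_mem' := by
    rintro c v ⟨u, hu, h⟩
    exact ⟨c • u, hu.const_smul c, (Lp.coeFn_smul c v).trans (h.const_smul c)⟩

/-- A function orthogonal to all functions with vanishing averages, in particular to the coboundaries,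
is invariant and hence constant. -/
theorem IsErgodicSystem.ae_eq_const_of_mem_orthogonal [IsProbabilityMeasure P]
    (hT : IsErgodicSystem P T) {v : Lp ℝ 2 P} (hv : v ∈ hT.vanishingSubmoduleᗮ) :
    ∃ c : ℝ, v =ᵐ[P] fun _ => c := by
  have hvi : Integrable v P := (Lp.memLp v).integrable (by norm_num)
  have hinv : ∀ y, v ∘ T y =ᵐ[P] v := by
    intro z
    obtain ⟨y, rfl⟩ : ∃ y, z = -y := ⟨-z, (neg_neg z).symm⟩
    have hvi' : Integrable (v ∘ T (-y)) P :=
      (hT.measurePreserving (-y)).integrable_comp_of_integrable hvi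
    refine hvi'.ae_eq_of_forall_setIntegral_eq _ _ hvi fun s hs _ => ?_
    -- Orthogonality to the coboundary of the indicator function of `s`.
    set u : Ω → ℝ := s.indicator fun _ => 1 with hu
    have hum : Measurable u := measurable_const.indicator hs
    have hub : ∃ C, ∀ ω, |u ω| ≤ C := ⟨1, fun ω => by
      by_cases h : ω ∈ s <;> simp [hu, h]⟩
    have hc := hT.vanishingAverages_sub_comp hum hub y
    have hL := memLp_of_measurable_of_bounded (P := P) hc.measurable hc.bounded 2
    have h0 := (Submodule.mem_orthogonal _ _).1 hv hL.toLp ⟨_, hc, hL.coeFn_toLp⟩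
    rw [L2.inner_def] at h0
    have hmulu : ∀ w : Ω → ℝ, Integrable w P → Integrable (fun ω => u ω * w ω) P := fun w hw =>
      hw.bdd_mul (c := hub.choose) hum.aestronglyMeasurable
        (Eventually.of_forall hub.choose_spec)
    have h1 : (∫ ω, u ω * v ω ∂P) - ∫ ω, u (T y ω) * v ω ∂P = 0 := by
      have hmulT : Integrable (fun ω => u (T y ω) * v ω) P := hvi.bdd_mul (c := hub.choose)
        (hum.comp (hT.measurePreserving y).measurable).aestronglyMeasurable
        (Eventually.of_forall fun _ => hub.choose_spec _)
      rw [← integral_sub (hmulu _ hvi) hmulT, ← h0]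
      refine integral_congr_ae ?_
      filter_upwards [hL.coeFn_toLp] with ω hω
      rw [hω]
      simp [mul_comm, mul_sub]
    have h2 : ∫ ω, u (T y ω) * v ω ∂P = ∫ ω, u ω * v (T (-y) ω) ∂P := by
      have hmp := hT.measurePreserving y
      have h3 : AEStronglyMeasurable (fun ω => u ω * v (T (-y) ω)) (Measure.map (T y) P) := by
        rw [hmp.map_eq]
        exact (hmulu _ hvi').aestronglyMeasurable
      have h4 := integral_map hmp.measurable.aemeasurable h3
      rw [hmp.map_eq] at h4
      rw [h4]
      simp only [hT.apply_neg_apply]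
    have h5 : ∀ w : Ω → ℝ, ∫ ω in s, w ω ∂P = ∫ ω, u ω * w ω ∂P := fun w => by
      rw [← integral_indicator hs]
      congr 1
      ext ω
      by_cases h : ω ∈ s <;> simp [hu, h]
    rw [h5, h5, sub_eq_zero.1 h1, h2]
    rfl
  obtain ⟨v', hv'm, hv'⟩ := (Lp.aestronglyMeasurable v).aemeasurable
  obtain ⟨c, hc⟩ := hT.ae_eq_const hv'm fun y =>
    ((hT.measurePreserving y).quasiMeasurePreserving.ae_eq_comp hv'.symm).trans
      ((hinv y).trans hv')
  exact ⟨c, hv'.trans hc⟩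

/-- A bounded function of mean zero has vanishing averages. -/
theorem IsErgodicSystem.vanishingAverages_of_integral_eq_zero [IsProbabilityMeasure P]
    (hT : IsErgodicSystem P T) {w : Ω → ℝ} (hw : Measurable w) (hb : ∃ C, ∀ ω, |w ω| ≤ C)
    (h0 : ∫ ω, w ω ∂P = 0) : VanishingAverages P T w := by
  have hL := memLp_of_measurable_of_bounded (P := P) hw hb 2
  have hmem : hL.toLp ∈ hT.vanishingSubmodule.topologicalClosure := by
    rw [← Submodule.orthogonal_orthogonal_eq_closure, Submodule.mem_orthogonal]
    intro v hv
    obtain ⟨c, hc⟩ := hT.ae_eq_const_of_mem_orthogonal hv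
    rw [L2.inner_def, ← mul_zero c, ← h0, ← integral_const_mul]
    refine integral_congr_ae ?_
    filter_upwards [hc, hL.coeFn_toLp] with ω h1 h2
    rw [h1, h2]
    simp [mul_comm]
  obtain ⟨v, hv, hvlim⟩ := mem_closure_iff_seq_limit.1 hmem
  choose u hu hvu using hv
  refine hT.vanishingAverages_of_tendsto hw hb hu ?_
  have hdist := (tendsto_iff_edist_tendsto_0.1 hvlim)
  refine tendsto_of_tendsto_of_tendsto_of_le_of_le tendsto_const_nhds hdist
    (fun n => zero_le) fun n => ?_
  simp only
  have he : (fun ω => w ω - u n ω) =ᵐ[P] hL.toLp - v n := by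
    filter_upwards [hL.coeFn_toLp, hvu n] with ω h1 h2
    rw [Pi.sub_apply, h1, h2]
  rw [edist_comm, Lp.edist_def, ← eLpNorm_congr_ae he, ← eLpNorm_one_eq_lintegral_enorm]
  exact eLpNorm_le_eLpNorm_of_exponent_le (by norm_num)
    (hw.sub (hu n).measurable).aestronglyMeasurable

/-- A property that holds almost surely holds along almost every orbit, at every scale. -/
theorem IsErgodicSystem.ae_orbit_of_ae [SFinite P] (hT : IsErgodicSystem P T) {p : Ω → Prop}
    (hp : ∀ᵐ ω ∂P, p ω) : ∀ᵐ ω ∂P, ∀ ε : ℝ, 0 < ε → ∀ᵐ x, p (T (ε⁻¹ • x) ω) := by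
  set N := toMeasurable P {ω | ¬p ω} with hN
  have hNm : MeasurableSet N := measurableSet_toMeasurable _ _
  have hN0 : P N = 0 := (measure_toMeasurable _).trans hp
  have hm := hT.aemeasurable_comp (β := ℝ≥0∞) (measurable_one.indicator hNm)
  have h0 := hT.lintegral_orbit (measurable_one.indicator hNm) univ
  rw [lintegral_indicator_one hNm, hN0, mul_zero, Measure.restrict_univ,
    lintegral_eq_zero_iff' hm.lintegral_prod_left'] at h0
  filter_upwards [h0, hm.aestronglyMeasurable.prod_swap.prodMk_left] with ω h1 h2 ε hε
  have h3 := (lintegral_eq_zero_iff' h2.aemeasurable).1 h1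
  refine (Measure.quasiMeasurePreserving_smul volume (inv_ne_zero hε.ne')).ae
    (p := fun x => p (T x ω)) ?_
  filter_upwards [h3] with x hx
  by_contra h
  have : T x ω ∈ N := subset_toMeasurable _ _ h
  simp [this] at hx

/-- The pointwise ergodic theorem for bounded functions, in the weak-* form. -/
theorem IsErgodicSystem.exists_ae_orbitConverges [IsProbabilityMeasure P]
    (hT : IsErgodicSystem P T) {f : Ω → ℝ} (hf : MemLp f ∞ P) :
    ∃ C, ∀ᵐ ω ∂P, OrbitConverges T f ω C (∫ ω, f ω ∂P) := by
  obtain ⟨C, hC⟩ : ∃ C : ℝ, ∀ᵐ ω ∂P, |f ω| ≤ C := by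
    refine ⟨(eLpNormEssSup f P).toReal, ?_⟩
    have hfin : eLpNormEssSup f P ≠ ∞ := by simpa using hf.2.ne
    filter_upwards [ae_le_eLpNormEssSup (f := f) (μ := P)] with ω h
    simpa using ENNReal.toReal_mono hfin h
  have hC0 : 0 ≤ C := let ⟨ω, h⟩ := hC.exists; (abs_nonneg _).trans h
  -- A representative that is measurable and bounded everywhere.
  obtain ⟨f₀, hf₀m, hf₀⟩ := hf.1.aemeasurable
  set f₁ : Ω → ℝ := fun ω => max (-C) (min C (f₀ ω)) with hf₁
  have hf₁m : Measurable f₁ := measurable_const.max (measurable_const.min hf₀m)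
  have hf₁b : ∀ ω, |f₁ ω| ≤ C := fun ω =>
    abs_le.2 ⟨le_max_left _ _, max_le (by linarith) (min_le_left _ _)⟩
  have hff₁ : ∀ᵐ ω ∂P, f ω = f₁ ω := by
    filter_upwards [hf₀, hC] with ω h1 h2
    rw [abs_le] at h2
    simp only [hf₁]
    rw [← h1, min_eq_right h2.2, max_eq_right h2.1]
  refine ⟨C, ?_⟩
  set c := ∫ ω, f ω ∂P with hc
  have hcf₁ : ∫ ω, f₁ ω ∂P = c := (integral_congr_ae hff₁).symm
  have hf₁i := memLp_one_iff_integrable.1 (memLp_of_measurable_of_bounded (P := P) hf₁m ⟨C, hf₁b⟩ 1)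
  have hvan : VanishingAverages P T (fun ω => f₁ ω - c) :=
    hT.vanishingAverages_of_integral_eq_zero (hf₁m.sub_const c)
      ⟨C + |c|, fun ω => (abs_sub _ _).trans (by gcongr; exact hf₁b ω)⟩ (by
      rw [integral_sub hf₁i (integrable_const c), hcf₁]; simp)
  filter_upwards [hvan.tendsto, hT.ae_orbit_aestronglyMeasurable hf₁m,
    hT.ae_orbit_of_ae hff₁] with ω h1 h2 h3
  refine ⟨fun ε hε => ?_, fun ε hε => ?_, fun g hg => ?_⟩
  · exact (aestronglyMeasurable_comp_inv_smul h2 hε).congr ((h3 ε hε).mono fun x hx => hx.symm)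
  · filter_upwards [h3 ε hε] with x hx
    rw [hx]; exact hf₁b _
  · have h4 : Tendsto (fun ε : ℝ => ∫ x, f₁ (T (ε⁻¹ • x) ω) * g x) (𝓝[>] 0)
        (𝓝 (c * ∫ x, g x)) := by
      refine tendsto_orbit_of_compactSupport hf₁b h2 (fun g hg hgc => ?_) g hg
      have hgi := hg.integrable_of_hasCompactSupport hgc (μ := volume)
      have h5 := (h1 g hg hgc).add_const (c * ∫ x, g x)
      rw [zero_add] at h5
      refine h5.congr' ?_
      filter_upwards [self_mem_nhdsWithin] with ε (hε : 0 < ε)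
      simp only [sub_mul]
      rw [integral_sub (integrable_orbit_mul hf₁b h2 hgi hε) (hgi.const_mul c),
        integral_const_mul, sub_add_cancel]
    refine h4.congr' ?_
    filter_upwards [self_mem_nhdsWithin] with ε (hε : 0 < ε)
    refine integral_congr_ae ?_
    filter_upwards [h3 ε hε] with x hx
    rw [hx]

end ErgodicTheorem

/-! ### Lipschitz integrands on the sphere -/

section LipschitzIntegrand

/-- An integrand `ψ(x, s)` that is Lipschitz in `s ∈ S²`, bounded, and measurable in `x` for `s` in
the range of the sequence `e` (which will be dense in the sphere). -/
structure IsLipschitzIntegrand (ν : Measure E3) (e : ℕ → E3) (L : ℝ) (ψ : E3 → E3 → ℝ) : Prop where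
  aestronglyMeasurable : ∀ n, AEStronglyMeasurable (fun x => ψ x (e n)) ν
  bound : ∃ C, ∀ᵐ x ∂ν, |ψ x (e 0)| ≤ C
  lipschitz : ∀ᵐ x ∂ν, ∀ s₁ ∈ S2, ∀ s₂ ∈ S2, |ψ x s₁ - ψ x s₂| ≤ L * ‖s₁ - s₂‖

variable {ν : Measure E3} {e : ℕ → E3} {L : ℝ} {ψ : E3 → E3 → ℝ}

theorem nearestPt_mem_sphere (he : ∀ n, e n ∈ S2) (N : ℕ) (s : E3) :
    SimpleFunc.nearestPt e N s ∈ S2 := he _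

theorem norm_sub_le_two {s₁ s₂ : E3} (h₁ : s₁ ∈ S2) (h₂ : s₂ ∈ S2) : ‖s₁ - s₂‖ ≤ 2 := by
  have := norm_sub_le s₁ s₂
  rw [mem_sphere_zero_iff_norm.1 h₁, mem_sphere_zero_iff_norm.1 h₂] at this
  linarith

/-- A function of an index `k ≤ N`, written as a finite sum over the values of the index. -/
theorem apply_eq_sum_indicator (f : ℕ → ℝ) {k N : ℕ} (hk : k ≤ N) :
    f k = ∑ n ∈ Finset.range (N + 1), f n * if k = n then 1 else 0 := by
  simp [Finset.sum_ite_eq, Nat.lt_succ_of_le hk]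

theorem IsLipschitzIntegrand.aestronglyMeasurable_nearestPt (hψ : IsLipschitzIntegrand ν e L ψ)
    {m : E3 → E3} (hm : Measurable m) (N : ℕ) :
    AEStronglyMeasurable (fun x => ψ x (SimpleFunc.nearestPt e N (m x))) ν := by
  have h : (fun x => ψ x (SimpleFunc.nearestPt e N (m x))) =
      fun x => ∑ n ∈ Finset.range (N + 1), ψ x (e n) *
        if SimpleFunc.nearestPtInd e N (m x) = n then 1 else 0 :=
    funext fun x => apply_eq_sum_indicator (fun n => ψ x (e n)) (SimpleFunc.nearestPtInd_le e N _)
  rw [h]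
  refine Finset.aestronglyMeasurable_fun_sum _ fun n _ => (hψ.aestronglyMeasurable n).mul ?_
  exact (Measurable.ite (((SimpleFunc.nearestPtInd e N).measurable.comp hm)
    (measurableSet_singleton n)) measurable_const measurable_const).aestronglyMeasurable

/-- Measurability of the superposition `x ↦ ψ(x, m(x))`, by approximating `m` with maps taking finitely
many values in the dense sequence. -/
theorem IsLipschitzIntegrand.aestronglyMeasurable_comp (hψ : IsLipschitzIntegrand ν e L ψ)
    (he : ∀ n, e n ∈ S2) (hd : S2 ⊆ closure (range e)) {m : E3 → E3} (hm : Measurable m)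
    (hmS : ∀ᵐ x ∂ν, m x ∈ S2) : AEStronglyMeasurable (fun x => ψ x (m x)) ν := by
  refine aestronglyMeasurable_of_tendsto_ae atTop
    (fun N => hψ.aestronglyMeasurable_nearestPt hm N) ?_
  filter_upwards [hψ.lipschitz, hmS] with x h1 h2
  have h3 := tendsto_iff_norm_sub_tendsto_zero.1 (SimpleFunc.tendsto_nearestPt (hd h2))
  have h4 := h3.const_mul L
  rw [mul_zero] at h4
  rw [tendsto_iff_norm_sub_tendsto_zero]
  exact squeeze_zero (fun _ => norm_nonneg _)
    (fun N => h1 _ (nearestPt_mem_sphere he N _) _ h2) h4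

theorem IsLipschitzIntegrand.integrable [IsFiniteMeasure ν] (hψ : IsLipschitzIntegrand ν e L ψ)
    (hL : 0 ≤ L) (he : ∀ n, e n ∈ S2) (hd : S2 ⊆ closure (range e)) {m : E3 → E3}
    (hm : Measurable m) (hmS : ∀ᵐ x ∂ν, m x ∈ S2) : Integrable (fun x => ψ x (m x)) ν := by
  obtain ⟨C, hC⟩ := hψ.bound
  refine Integrable.of_bound (hψ.aestronglyMeasurable_comp he hd hm hmS) (L * 2 + C) ?_
  filter_upwards [hψ.lipschitz, hmS, hC] with x h1 h2 h3
  have h4 := (h1 _ h2 _ (he 0)).trans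
    (mul_le_mul_of_nonneg_left (norm_sub_le_two h2 (he 0)) hL)
  rw [Real.norm_eq_abs]
  have := abs_add_le (ψ x (m x) - ψ x (e 0)) (ψ x (e 0))
  rw [sub_add_cancel] at this
  linarith

theorem integrable_norm_sub_of_sphere [IsFiniteMeasure ν] {m m' : E3 → E3} (hm : Measurable m)
    (hm' : Measurable m') (hmS : ∀ᵐ x ∂ν, m x ∈ S2) (hmS' : ∀ᵐ x ∂ν, m' x ∈ S2) :
    Integrable (fun x => ‖m x - m' x‖) ν := by
  refine Integrable.of_bound (hm.sub hm').norm.aestronglyMeasurable 2 ?_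
  filter_upwards [hmS, hmS'] with x h1 h2
  rw [norm_norm]
  exact norm_sub_le_two h1 h2

theorem IsLipschitzIntegrand.abs_integral_sub_le [IsFiniteMeasure ν]
    (hψ : IsLipschitzIntegrand ν e L ψ) (hL : 0 ≤ L) (he : ∀ n, e n ∈ S2)
    (hd : S2 ⊆ closure (range e)) {m m' : E3 → E3} (hm : Measurable m) (hm' : Measurable m')
    (hmS : ∀ᵐ x ∂ν, m x ∈ S2) (hmS' : ∀ᵐ x ∂ν, m' x ∈ S2) :
    |(∫ x, ψ x (m x) ∂ν) - ∫ x, ψ x (m' x) ∂ν| ≤ L * ∫ x, ‖m x - m' x‖ ∂ν := by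
  rw [← integral_sub (hψ.integrable hL he hd hm hmS) (hψ.integrable hL he hd hm' hmS'),
    ← integral_const_mul]
  refine norm_integral_le_of_norm_le (f := fun x => ψ x (m x) - ψ x (m' x))
    ((integrable_norm_sub_of_sphere hm hm' hmS hmS').const_mul L) ?_
  filter_upwards [hψ.lipschitz, hmS, hmS'] with x h1 h2 h3
  exact h1 _ h2 _ h3

theorem tendsto_integral_norm_nearestPt_sub [IsFiniteMeasure ν] (he : ∀ n, e n ∈ S2)
    (hd : S2 ⊆ closure (range e)) {m : E3 → E3} (hm : Measurable m)
    (hmS : ∀ᵐ x ∂ν, m x ∈ S2) :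
    Tendsto (fun N => ∫ x, ‖SimpleFunc.nearestPt e N (m x) - m x‖ ∂ν) atTop (𝓝 0) := by
  rw [← integral_zero E3 ℝ (μ := ν)]
  refine tendsto_integral_of_dominated_convergence (fun _ => 2) (fun N => ?_)
    (integrable_const 2) (fun N => ?_) ?_
  · exact (((SimpleFunc.nearestPt e N).measurable.comp hm).sub hm).norm.aestronglyMeasurable
  · filter_upwards [hmS] with x hx
    rw [norm_norm]
    exact norm_sub_le_two (nearestPt_mem_sphere he N _) hx
  · filter_upwards [hmS] with x hx
    exact tendsto_iff_norm_sub_tendsto_zero.1 (SimpleFunc.tendsto_nearestPt (hd hx))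

end LipschitzIntegrand

/-! ### Convergence of the energies along a fixed orbit -/

section Energies

variable {D : Set E3} {Ω : Type*} {T : E3 → Ω → Ω} {ω : Ω}

/-- The Cauchy–Schwarz inequality in `L²(D)`. -/
theorem integral_norm_mul_norm_le {h : E3 → E3} (hh : MemLp h 2 (volume.restrict D)) (u : L2 D) :
    Integrable (fun x => ‖h x‖ * ‖u x‖) (volume.restrict D) ∧
    ∫ x in D, ‖h x‖ * ‖u x‖ ≤ (eLpNorm h 2 (volume.restrict D)).toReal * ‖u‖ := by
  have hu := (Lp.memLp u).norm
  have hh' := hh.norm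
  refine ⟨hh'.integrable_mul hu, ?_⟩
  have h1 := real_inner_le_norm hh'.toLp hu.toLp
  rw [L2.inner_def, Lp.norm_toLp, Lp.norm_toLp, eLpNorm_norm, eLpNorm_norm] at h1
  refine le_of_eq_of_le (integral_congr_ae ?_) h1
  filter_upwards [hh'.coeFn_toLp, hu.coeFn_toLp] with x h2 h3
  rw [h2, h3]
  simp [mul_comm]

/-- The embedding of `L²(D)` into `L¹(D)`; the constant field of a unit vector is the second factor in
the Cauchy–Schwarz inequality. -/
theorem integral_norm_le [IsFiniteMeasure (volume.restrict D)] (u : L2 D) :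
    ∫ x in D, ‖u x‖ ≤
      (eLpNorm (fun _ : E3 => (EuclideanSpace.single 0 1 : E3)) 2 (volume.restrict D)).toReal *
        ‖u‖ := by
  simpa using (integral_norm_mul_norm_le
    (memLp_const (μ := volume.restrict D) (EuclideanSpace.single 0 1 : E3)) u).2

theorem tendsto_integral_norm_sub [IsFiniteMeasure (volume.restrict D)] (m₀ : L2 D) :
    Tendsto (fun m : L2 D => ∫ x in D, ‖m x - m₀ x‖) (𝓝 m₀) (𝓝 0) := by
  set K := (eLpNorm (fun _ : E3 => (EuclideanSpace.single 0 1 : E3)) 2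
    (volume.restrict D)).toReal with hK
  have hlim : Tendsto (fun m : L2 D => K * ‖m - m₀‖) (𝓝 m₀) (𝓝 0) := by
    have : Continuous fun m : L2 D => K * ‖m - m₀‖ := by fun_prop
    simpa using this.tendsto m₀
  refine squeeze_zero (fun m => integral_nonneg fun x => norm_nonneg _) (fun m => ?_) hlim
  refine le_of_eq_of_le (integral_congr_ae ?_) (integral_norm_le (m - m₀))
  filter_upwards [Lp.coeFn_sub m m₀] with x hx
  rw [hx, Pi.sub_apply]

theorem measurable_coeFn_L2 (m : L2 D) : Measurable m := (Lp.stronglyMeasurable m).measurable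

variable {φ : Ω → E3 → ℝ} {Φ : E3 → ℝ} {e : ℕ → E3} {C : ℕ → ℝ} {L : ℝ}

/-- Weak-* convergence of the orbit functions `φ(T_{x/ε} ω, e n)` gives the convergence of the
anisotropy energies of magnetizations with values in a finite part of the range of `e`. -/
theorem tendsto_integral_nearestPt (hDm : MeasurableSet D) [IsFiniteMeasure (volume.restrict D)]
    (hC : ∀ n, OrbitConverges T (fun ω => φ ω (e n)) ω (C n) (Φ (e n))) {m : E3 → E3}
    (hm : Measurable m) (N : ℕ) :
    Tendsto (fun ε : ℝ => ∫ x in D, φ (T (ε⁻¹ • x) ω) (SimpleFunc.nearestPt e N (m x)))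
      (𝓝[>] 0) (𝓝 (∫ x in D, Φ (SimpleFunc.nearestPt e N (m x)))) := by
  set A : ℕ → Set E3 := fun n => {x | SimpleFunc.nearestPtInd e N (m x) = n} with hA
  have hAm : ∀ n, MeasurableSet (A n) := fun n =>
    ((SimpleFunc.nearestPtInd e N).measurable.comp hm) (measurableSet_singleton n)
  set g : ℕ → E3 → ℝ := fun n x => if SimpleFunc.nearestPtInd e N (m x) = n then 1 else 0 with hg
  have hgi : ∀ n, Integrable (g n) (volume.restrict D) := fun n => by
    refine Integrable.of_bound (Measurable.ite (hAm n) measurable_const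
      measurable_const).aestronglyMeasurable 1 (Eventually.of_forall fun x => ?_)
    simp only [hg]
    split_ifs <;> simp
  have hind : ∀ n (F : E3 → ℝ), ∫ x in D, F x * g n x = ∫ x, F x * D.indicator (g n) x := by
    intro n F
    rw [← integral_indicator hDm]
    simp only [indicator_mul_right]
  have hsum : Tendsto (fun ε : ℝ => ∑ n ∈ Finset.range (N + 1),
      ∫ x in D, φ (T (ε⁻¹ • x) ω) (e n) * g n x) (𝓝[>] 0)
      (𝓝 (∑ n ∈ Finset.range (N + 1), ∫ x in D, Φ (e n) * g n x)) := by
    refine tendsto_finsetSum _ fun n _ => ?_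
    simp only [hind]
    rw [integral_const_mul]
    exact (hC n).tendsto _ ((integrable_indicator_iff hDm).2 (hgi n))
  have hr : ∫ x in D, Φ (SimpleFunc.nearestPt e N (m x)) =
      ∑ n ∈ Finset.range (N + 1), ∫ x in D, Φ (e n) * g n x := by
    rw [← integral_finsetSum _ fun n _ => (hgi n).const_mul _]
    exact integral_congr_ae (Eventually.of_forall fun x => apply_eq_sum_indicator
      (fun n => Φ (e n)) (SimpleFunc.nearestPtInd_le e N _))
  rw [hr]
  refine hsum.congr' ?_
  filter_upwards [self_mem_nhdsWithin] with ε hε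
  rw [← integral_finsetSum _ fun n _ => (hgi n).bdd_mul (c := C n)
    ((hC n).aestronglyMeasurable ε hε).restrict (ae_restrict_of_ae ((hC n).bound ε hε))]
  exact integral_congr_ae (Eventually.of_forall fun x => (apply_eq_sum_indicator
      (fun n => φ (T (ε⁻¹ • x) ω) (e n)) (SimpleFunc.nearestPtInd_le e N _)).symm)

/-- Continuous convergence of the anisotropy energies: the magnetization is replaced by a finitely
valued one, uniformly in `ε` at a cost controlled by the Lipschitz constant. -/
theorem convergesContinuously_anisotropyEnergy (hDm : MeasurableSet D)
    [IsFiniteMeasure (volume.restrict D)] (hL : 0 ≤ L) (he : ∀ n, e n ∈ S2)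
    (hd : S2 ⊆ closure (range e))
    (hC : ∀ n, OrbitConverges T (fun ω => φ ω (e n)) ω (C n) (Φ (e n)))
    (hφ : ∀ ε : ℝ, 0 < ε → IsLipschitzIntegrand (volume.restrict D) e L
      fun x s => φ (T (ε⁻¹ • x) ω) s)
    (hΦ : IsLipschitzIntegrand (volume.restrict D) e L fun _ s => Φ s) :
    ConvergesContinuously
      (fun ε (m : L2Sphere D) => anisotropyEnergy T φ ω ε (m : L2 D))
      (fun m => ∫ x in D, Φ ((m : L2 D) x)) := by
  intro m₀
  rw [Metric.tendsto_nhds]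
  intro η hη
  have hm₀ := measurable_coeFn_L2 (m₀ : L2 D)
  have hm₀S : ∀ᵐ x ∂(volume.restrict D), (m₀ : L2 D) x ∈ S2 := m₀.2
  have hlim := (tendsto_integral_norm_nearestPt_sub he hd hm₀ hm₀S).const_mul L
  rw [mul_zero] at hlim
  obtain ⟨N, hN⟩ := (hlim.eventually (gt_mem_nhds (show 0 < η / 4 by positivity))).exists
  have hlim' := (((tendsto_integral_norm_sub (m₀ : L2 D)).comp
    (continuous_subtype_val.tendsto m₀)).const_mul L)
  rw [mul_zero] at hlim'
  filter_upwards [(hlim'.eventually (gt_mem_nhds (show 0 < η / 4 by positivity))).prod_inr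
      (𝓝[>] (0 : ℝ)),
    (Metric.tendsto_nhds.1 (tendsto_integral_nearestPt hDm hC hm₀ N) (η / 4)
      (by positivity)).prod_inl (𝓝 m₀),
    (eventually_mem_nhdsWithin (a := (0 : ℝ)) (s := Ioi 0)).prod_inl (𝓝 m₀)]
    with ⟨ε, m⟩ h1 h2 h3
  simp only [Function.comp] at h1 h2 h3 ⊢
  have hm := measurable_coeFn_L2 (m : L2 D)
  have hmS : ∀ᵐ x ∂(volume.restrict D), (m : L2 D) x ∈ S2 := m.2
  have hnear : Measurable fun x => SimpleFunc.nearestPt e N ((m₀ : L2 D) x) :=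
    (SimpleFunc.nearestPt e N).measurable.comp hm₀
  have hnearS : ∀ᵐ x ∂(volume.restrict D), SimpleFunc.nearestPt e N ((m₀ : L2 D) x) ∈ S2 :=
    Eventually.of_forall fun x => nearestPt_mem_sphere he N _
  have a1 := (hφ ε h3).abs_integral_sub_le hL he hd hm hm₀ hmS hm₀S
  have a2 := (hφ ε h3).abs_integral_sub_le hL he hd hnear hm₀ hnearS hm₀S
  have a3 := hΦ.abs_integral_sub_le hL he hd hnear hm₀ hnearS hm₀S
  rw [Real.dist_eq] at h2 ⊢
  simp only [anisotropyEnergy, anisotropyDensity]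
  rw [abs_le] at a1 a2 a3
  rw [abs_lt] at h2 ⊢
  constructor <;> linarith [a1.1, a1.2, a2.1, a2.2, a3.1, a3.2, h2.1, h2.2]

theorem zeemanDensity_eq {Msat : Ω → ℝ} {ha : E3 → E3} {ε : ℝ} {m : L2 D} (x : E3) :
    zeemanDensity T Msat ha ω ε m x = Msat (T (ε⁻¹ • x) ω) * inner ℝ (ha x) (m x) :=
  inner_smul_right _ _ _

theorem integrable_inner_L2 {ha : E3 → E3} (hha : MemLp ha 2 (volume.restrict D)) (m : L2 D) :
    Integrable (fun x => (inner ℝ (ha x) (m x) : ℝ)) (volume.restrict D) := by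
  refine (L2.integrable_inner hha.toLp m).congr ?_
  filter_upwards [hha.coeFn_toLp] with x hx
  rw [hx]

theorem integrable_zeemanDensity {Msat : Ω → ℝ} {C c : ℝ} (hC : OrbitConverges T Msat ω C c)
    {ha : E3 → E3} (hha : MemLp ha 2 (volume.restrict D)) (m : L2 D) {ε : ℝ} (hε : 0 < ε) :
    IntegrableOn (zeemanDensity T Msat ha ω ε m) D := by
  refine Integrable.congr ((integrable_inner_L2 hha m).bdd_mul (c := C)
    (hC.aestronglyMeasurable ε hε).restrict (ae_restrict_of_ae (hC.bound ε hε))) ?_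
  exact Eventually.of_forall fun x => (zeemanDensity_eq x).symm

theorem convergesContinuously_zeemanEnergy (hDm : MeasurableSet D) {Msat : Ω → ℝ} {C c : ℝ}
    (hC : OrbitConverges T Msat ω C c) {ha : E3 → E3} (hha : MemLp ha 2 (volume.restrict D))
    (μ₀ : ℝ) :
    ConvergesContinuously
      (fun ε (m : L2Sphere D) => zeemanEnergy T Msat ha μ₀ ω ε (m : L2 D))
      (fun m => -μ₀ * ∫ x in D, inner ℝ (ha x) (c • (m : L2 D) x)) := by
  intro m₀
  refine Tendsto.const_mul (-μ₀) ?_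
  set K := (eLpNorm ha 2 (volume.restrict D)).toReal with hK
  -- For fixed `m₀`, the test function is the integrable function `h_a · m₀`.
  have h1 : Tendsto (fun ε : ℝ => ∫ x in D, zeemanDensity T Msat ha ω ε (m₀ : L2 D) x) (𝓝[>] 0)
      (𝓝 (∫ x in D, inner ℝ (ha x) (c • (m₀ : L2 D) x))) := by
    have := hC.tendsto _ ((integrable_indicator_iff hDm).2 (integrable_inner_L2 hha (m₀ : L2 D)))
    simp only [zeemanDensity_eq, inner_smul_right]
    rw [integral_const_mul, ← integral_indicator hDm]
    refine this.congr fun ε => ?_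
    rw [← integral_indicator hDm]
    simp only [indicator_mul_right]
  have h2 : Tendsto (fun p : ℝ × L2Sphere D =>
      (∫ x in D, zeemanDensity T Msat ha ω p.1 (p.2 : L2 D) x) -
        ∫ x in D, zeemanDensity T Msat ha ω p.1 (m₀ : L2 D) x)
      (𝓝[>] (0 : ℝ) ×ˢ 𝓝 m₀) (𝓝 0) := by
    have hlim : Tendsto (fun p : ℝ × L2Sphere D => |C| * (K * ‖(p.2 : L2 D) - m₀‖))
        (𝓝[>] (0 : ℝ) ×ˢ 𝓝 m₀) (𝓝 0) := by
      have hcont : Continuous fun m : L2Sphere D => |C| * (K * ‖(m : L2 D) - m₀‖) := by fun_prop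
      have := (hcont.tendsto m₀).comp (tendsto_snd (f := 𝓝[>] (0 : ℝ)))
      simpa [Function.comp_def] using this
    refine squeeze_zero_norm' ?_ hlim
    filter_upwards [(eventually_mem_nhdsWithin (a := (0 : ℝ)) (s := Ioi 0)).prod_inl (𝓝 m₀)]
      with ⟨ε, m⟩ (hε : 0 < ε)
    simp only
    obtain ⟨hi, hle⟩ := integral_norm_mul_norm_le hha ((m : L2 D) - m₀)
    rw [← integral_sub (integrable_zeemanDensity hC hha _ hε)
      (integrable_zeemanDensity hC hha _ hε)]
    refine (norm_integral_le_of_norm_le (hi.const_mul |C|) ?_).trans ?_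
    · filter_upwards [Lp.coeFn_sub (m : L2 D) m₀, ae_restrict_of_ae (hC.bound ε hε)] with x h3 h4
      rw [zeemanDensity_eq, zeemanDensity_eq, ← mul_sub, ← inner_sub_right, norm_mul, h3]
      exact mul_le_mul (h4.trans (le_abs_self C)) (norm_inner_le_norm _ _) (norm_nonneg _)
        (abs_nonneg C)
    · rw [integral_const_mul]
      exact mul_le_mul_of_nonneg_left hle (abs_nonneg C)
  simpa using h2.add (h1.comp tendsto_fst)

end Energies

/-! ### Weak convergence in `H¹(D; S²)` -/

section Weak

variable {D : Set E3}

theorem norm_eq_of_mem_L2Sphere {m m' : L2 D} (hm : m ∈ L2Sphere D) (hm' : m' ∈ L2Sphere D) :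
    ‖m‖ = ‖m'‖ := by
  rw [Lp.norm_def, Lp.norm_def]
  congr 1
  refine eLpNorm_congr_norm_ae ?_
  filter_upwards [hm, hm'] with x h1 h2
  rw [mem_sphere_zero_iff_norm.1 h1, mem_sphere_zero_iff_norm.1 h2]

/-- On maps with values in the sphere, weak convergence in `H¹` implies strong convergence in `L²`:
it implies weak convergence in `L²`, and all these maps have the same `L²` norm. -/
theorem tendsto_toL2_of_tendsto {u : ℕ → H1Sphere D} {w : H1Sphere D}
    (h : Tendsto u atTop (𝓝 w)) :
    Tendsto (fun j => H1.toL2 (u j : WeakSpace ℝ (H1 D))) atTop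
      (𝓝 (H1.toL2 (w : WeakSpace ℝ (H1 D)))) := by
  set m₀ := H1.toL2 (w : WeakSpace ℝ (H1 D)) with hm₀
  have hinner : Tendsto (fun j => inner ℝ m₀ (H1.toL2 (u j : WeakSpace ℝ (H1 D)))) atTop
      (𝓝 (inner ℝ m₀ m₀)) := by
    let ℓ : H1 D →L[ℝ] ℝ := (innerSL ℝ m₀).comp ((WithLp.fstL 2 ℝ (L2 D)
      (PiLp 2 (fun _ : Fin 3 => L2 D))).comp (H1 D).subtypeL)
    have hcont : Continuous fun x : WeakSpace ℝ (H1 D) => inner ℝ m₀ (H1.toL2 x) :=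
      WeakBilin.eval_continuous (topDualPairing ℝ (H1 D)).flip ℓ
    exact ((hcont.comp continuous_subtype_val).tendsto w).comp h
  rw [tendsto_iff_norm_sub_tendsto_zero]
  have hsq : Tendsto (fun j => ‖H1.toL2 (u j : WeakSpace ℝ (H1 D)) - m₀‖ ^ 2) atTop (𝓝 0) := by
    have h2 := (hinner.const_mul (-2)).add_const (2 * ‖m₀‖ ^ 2)
    rw [real_inner_self_eq_norm_sq, show -2 * ‖m₀‖ ^ 2 + 2 * ‖m₀‖ ^ 2 = 0 by ring] at h2
    refine h2.congr fun j => ?_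
    rw [norm_sub_sq_real, norm_eq_of_mem_L2Sphere (u j).2 w.2, ← hm₀, real_inner_comm]
    ring
  have := hsq.sqrt
  simpa using this

theorem ConvergesContinuously.seq_toL2 {F : ℝ → L2 D → ℝ} {F₀ : L2 D → ℝ}
    (h : ConvergesContinuously (fun ε (m : L2Sphere D) => F ε m) (fun m => F₀ m)) :
    SeqConvergesContinuously
      (fun ε (w : H1Sphere D) => F ε (H1.toL2 (w : WeakSpace ℝ (H1 D))))
      (fun w => F₀ (H1.toL2 (w : WeakSpace ℝ (H1 D)))) := by
  intro ε u w hε hε0 hu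
  have h1 : Tendsto ε atTop (𝓝[>] 0) :=
    tendsto_nhdsWithin_iff.2 ⟨hε0, Eventually.of_forall hε⟩
  have h2 : Tendsto (fun j => (⟨H1.toL2 (u j : WeakSpace ℝ (H1 D)), (u j).2⟩ : L2Sphere D)) atTop
      (𝓝 ⟨H1.toL2 (w : WeakSpace ℝ (H1 D)), w.2⟩) :=
    tendsto_subtype_rng.2 (tendsto_toL2_of_tendsto hu)
  exact (h ⟨H1.toL2 (w : WeakSpace ℝ (H1 D)), w.2⟩).comp (h1.prodMk h2)

end Weak

end RandomMicromagnetics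

open RandomMicromagnetics in
theorem proposition2p9 {Ω : Type*} [MetricSpace Ω] [CompactSpace Ω] [MeasurableSpace Ω]
    [OpensMeasurableSpace Ω] (P : Measure Ω) [IsProbabilityMeasure P]
    (T : E3 → Ω → Ω) (hT : IsErgodicSystem P T)
    (D : Set E3) (hDo : IsOpen D) (hDb : Bornology.IsBounded D)
    (φ : Ω → E3 → ℝ) (hφ : IsAnisotropyDensity P φ)
    (Msat : Ω → ℝ) (hM : IsSaturation P Msat)
    (ha : E3 → E3) (hha : MemLp ha 2 (volume.restrict D)) (μ₀ : ℝ) :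
    ∀ᵐ ω ∂P,
      -- the integrals defining the four energies exist
      (∀ m ∈ L2Sphere D,
        (∀ ε : ℝ, 0 < ε →
          IntegrableOn (anisotropyDensity T φ ω ε m) D ∧
          IntegrableOn (zeemanDensity T Msat ha ω ε m) D) ∧
        IntegrableOn (anisotropyDensityHom P φ m) D ∧
        IntegrableOn (zeemanDensityHom P Msat ha m) D) ∧
      -- continuous convergence in the strong topology of L²(D; S²)
      ConvergesContinuously
        (fun ε (m : L2Sphere D) => anisotropyEnergy T φ ω ε (m : L2 D))
        (fun m => anisotropyEnergyHom P φ (m : L2 D)) ∧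
      ConvergesContinuously
        (fun ε (m : L2Sphere D) => zeemanEnergy T Msat ha μ₀ ω ε (m : L2 D))
        (fun m => zeemanEnergyHom P Msat ha μ₀ (m : L2 D)) ∧
      -- continuous convergence along weakly convergent sequences of H¹(D; S²)
      SeqConvergesContinuously
        (fun ε (w : H1Sphere D) => anisotropyEnergy T φ ω ε (H1.toL2 (w : WeakSpace ℝ (H1 D))))
        (fun w => anisotropyEnergyHom P φ (H1.toL2 (w : WeakSpace ℝ (H1 D)))) ∧
      SeqConvergesContinuously
        (fun ε (w : H1Sphere D) =>
          zeemanEnergy T Msat ha μ₀ ω ε (H1.toL2 (w : WeakSpace ℝ (H1 D))))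
        (fun w => zeemanEnergyHom P Msat ha μ₀ (H1.toL2 (w : WeakSpace ℝ (H1 D)))) := by
  have hDm := hDo.measurableSet
  have : IsFiniteMeasure (volume.restrict D) :=
    isFiniteMeasure_restrict.2 hDb.measure_lt_top.ne
  have : Nonempty S2 := ⟨⟨EuclideanSpace.single 0 1, by simp⟩⟩
  obtain ⟨e', he'⟩ := TopologicalSpace.exists_dense_seq S2
  set e : ℕ → E3 := fun n => e' n with he_def
  have he : ∀ n, e n ∈ S2 := fun n => (e' n).2
  have hd : S2 ⊆ closure (range e) := by
    intro s hs
    have h1 : (s : E3) ∈ Subtype.val '' closure (range e') := ⟨⟨s, hs⟩, he' _, rfl⟩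
    have h2 := image_closure_subset_closure_image continuous_subtype_val h1
    rwa [← range_comp] at h2
  obtain ⟨L, hL, hlip⟩ := hφ.lipschitz
  choose C hC using fun n => hT.exists_ae_orbitConverges (hφ.memLp (e n) (he n))
  obtain ⟨C', hC'⟩ := hT.exists_ae_orbitConverges hM.memLp
  have hΦ : IsLipschitzIntegrand (volume.restrict D) e L fun _ s => ∫ ω, φ ω s ∂P := by
    refine ⟨fun n => aestronglyMeasurable_const, ⟨_, Eventually.of_forall fun _ => le_rfl⟩,
      Eventually.of_forall fun x s₁ h₁ s₂ h₂ => ?_⟩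
    rw [← integral_sub ((hφ.memLp _ h₁).integrable (by simp))
      ((hφ.memLp _ h₂).integrable (by simp)), ← Real.norm_eq_abs]
    refine (norm_integral_le_of_norm_le_const (C := L * ‖s₁ - s₂‖) ?_).trans (by simp)
    filter_upwards [hlip] with ω hω using hω s₁ h₁ s₂ h₂
  filter_upwards [ae_all_iff.2 hC, hC', hT.ae_orbit_of_ae hlip] with ω h1 h2 h3
  have hφL : ∀ ε : ℝ, 0 < ε → IsLipschitzIntegrand (volume.restrict D) e L
      fun x s => φ (T (ε⁻¹ • x) ω) s := fun ε hε =>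
    ⟨fun n => ((h1 n).aestronglyMeasurable ε hε).restrict,
      ⟨C 0, ae_restrict_of_ae ((h1 0).bound ε hε)⟩, ae_restrict_of_ae (h3 ε hε)⟩
  have hA : ConvergesContinuously
      (fun ε (m : L2Sphere D) => anisotropyEnergy T φ ω ε (m : L2 D))
      (fun m => anisotropyEnergyHom P φ (m : L2 D)) :=
    convergesContinuously_anisotropyEnergy hDm hL.le he hd h1 hφL hΦ
  have hZ : ConvergesContinuously
      (fun ε (m : L2Sphere D) => zeemanEnergy T Msat ha μ₀ ω ε (m : L2 D))
      (fun m => zeemanEnergyHom P Msat ha μ₀ (m : L2 D)) :=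
    convergesContinuously_zeemanEnergy hDm h2 hha μ₀
  refine ⟨fun m hm => ⟨fun ε hε => ⟨?_, integrable_zeemanDensity h2 hha m hε⟩, ?_, ?_⟩, hA, hZ,
    hA.seq_toL2, hZ.seq_toL2⟩
  · exact (hφL ε hε).integrable hL.le he hd (measurable_coeFn_L2 m) hm
  · exact hΦ.integrable hL.le he hd (measurable_coeFn_L2 m) hm
  · refine ((integrable_inner_L2 hha m).const_mul (∫ ω, Msat ω ∂P)).congr ?_
    exact Eventually.of_forall fun x => (inner_smul_right _ _ _).symm
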